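/- **Definitions.** Let $k\ge 2$ and let $\Sigma$ be a finite alphabet. An *almost $k$-ary finite tree of height $0$* is a single $\Sigma$-labelled node; one of height $h+1$ is a $\Sigma$-labelled finite ordered tree whose root has exactly $k-1$ sons, each of them the root of a complete finite $k$-ary tree of height $h$. An *increasing $k$-ary tree sequence* is a sequence $(t_i)_{i\in\mathbb N}$ in which $t_i$ is an almost $k$-ary finite tree of height $i$; $ITS_k(\Sigma)$ is the set of all of them (they represent the $\Sigma$-labelled $k$-refinable upward unbounded layered structures, UULSs). An *almost $k$-ary finite tree automaton* $X=(Q,q_0,\Delta,F)$ over $\Sigma$ is a nondeterministic top-down finite tree automaton with finite state set $Q$, initial state $q_0$, final states $F\subseteq Q$ and transitions $\Delta\subseteq (Q\times\Sigma\times Q^{k-1})\cup(Q\times\Sigma\times Q^{k})$, where the transitions with $k-1$ successor states apply at the root and those with $k$ successor states at all other nodes. A run labels with states the nodes of the tree and the nodes of its outer frontier ($k$ additional sons below each leaf; $k-1$ if the leaf is the root), in accordance with $\Delta$; it is accepting if the root has state $q_0$ and all nodes of the outer frontier have states in $F$. $\mathcal L(X)$ is the set of trees that have an accepting run. A *finite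 tree sequence automaton* $A=(Q,q_0,\Delta,F)$ consists of a finite state set $Q$, an initial state $q_0$, final states $F\subseteq Q$, a finite alphabet $\Gamma$ whose symbols denote almost $k$-ary finite tree automata over $\Sigma$, and $\Delta\subseteq Q\times\Gamma\times Q$. It accepts a sequence $(t_i)_{i\in\mathbb N}$ of almost $k$-ary finite trees if there is $\sigma:\mathbb N\to Q$ with $\sigma(0)=q_0$ such that for every $i$ there is $X\in\Gamma$ with $(\sigma(i),X,\sigma(i+1))\in\Delta$ and $t_i\in\mathcal L(X)$, and some state of $F$ occurs infinitely often in $\sigma$. $\mathcal L(A)$ is the set of accepted sequences. **Theorem.** The emptiness problem for finite tree sequence automata over UULSs is in 2EXPTIME: there are a multi-tape Turing machine and a polynomial $p$ such that, given (an encoding of length $n$ of) $k\ge2$, $\Sigma$ and a finite tree sequence automaton $A$ over $\Sigma$ with arity $k$, with all state sets and alphabets initial segments $\{0,\dots,m-1\}$ of $\mathbb N$, transition relations and sets of final states given as explicit lists, and numbers written in binary, the machine decides whether $\mathcal L(A)\cap ITS_k(\Sigma)\neq\emptyset$ in at most $2^{2^{p(n)}}$ steps. -/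

import Mathlib

namespace TreeSeq

/-! ### Trees and increasing tree sequences -/

/-- `CompleteTree k α h`: the complete (ordered) finite `k`-ary trees of height `h` whose nodes are
labelled by elements of `α`. -/
inductive CompleteTree (k : ℕ) (α : Type) : ℕ → Type
  | leaf (a : α) : CompleteTree k α 0
  | node {h : ℕ} (a : α) (sons : Fin k → CompleteTree k α h) : CompleteTree k α (h + 1)

/-- The label of the root. -/
def CompleteTree.root {k : ℕ} {α : Type} : {h : ℕ} → CompleteTree k α h → α
  | _, .leaf a => a
  | _, .node a _ => a

/-- `AlmostTree k α h`: the `α`-labelled almost `k`-ary finite trees of height `h`. The root of such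
a tree has exactly `k - 1` sons (none, if the height is `0`), each of them the root of a
complete finite `k`-ary tree, all of the same height. -/
inductive AlmostTree (k : ℕ) (α : Type) : ℕ → Type
  | leaf (a : α) : AlmostTree k α 0
  | node {h : ℕ} (a : α) (sons : Fin (k - 1) → CompleteTree k α h) : AlmostTree k α (h + 1)

/-- The label of the root. -/
def AlmostTree.root {k : ℕ} {α : Type} : {h : ℕ} → AlmostTree k α h → α
  | _, .leaf a => a
  | _, .node a _ => a

/-- The set of all `α`-labelled almost `k`-ary finite trees, of any height. -/
def FinAlmostTree (k : ℕ) (α : Type) : Type := Σ h : ℕ, AlmostTree k α h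

/-- The height of an almost `k`-ary finite tree. -/
def FinAlmostTree.height {k : ℕ} {α : Type} (t : FinAlmostTree k α) : ℕ := t.1

/-- The set of increasing `k`-ary tree sequences: the `i`-th tree has height `i`. -/
def ITS (k : ℕ) (α : Type) : Set (ℕ → FinAlmostTree k α) :=
  {g | ∀ i, (g i).height = i}

/-! ### Almost `k`-ary finite tree automata -/

/-- A nondeterministic (top-down) automaton on almost `k`-ary finite trees over the alphabet
`{0, …, s - 1}`: finitely many states `0, …, numStates - 1`, an initial state, a transition relation
and a set of final states, all given by explicit lists. As the root of an almost `k`-ary tree has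
`k - 1` sons and all the other nodes have `k` sons, the transition relation consists of a part
`rootTrans ⊆ Q × Σ × Q ^ (k - 1)` and a part `trans ⊆ Q × Σ × Q ^ k`. -/
structure AlmostTreeAutomaton (k s : ℕ) where
  numStates : ℕ
  start : Fin numStates
  rootTrans : List (Fin numStates × Fin s × (Fin (k - 1) → Fin numStates))
  trans : List (Fin numStates × Fin s × (Fin k → Fin numStates))
  final : List (Fin numStates)

/-- All the leaves of a complete tree have their label in `F`. -/
def CompleteTree.LeavesIn {k : ℕ} {α : Type} (F : Set α) :
    {h : ℕ} → CompleteTree k α h → Prop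
  | _, .leaf a => a ∈ F
  | _, .node _ sons => ∀ i, (sons i).LeavesIn F

/-- All the leaves of an almost `k`-ary tree have their label in `F`. -/
def AlmostTree.LeavesIn {k : ℕ} {α : Type} (F : Set α) :
    {h : ℕ} → AlmostTree k α h → Prop
  | _, .leaf a => a ∈ F
  | _, .node _ sons => ∀ i, (sons i).LeavesIn F

namespace AlmostTreeAutomaton

variable {k s : ℕ} (X : AlmostTreeAutomaton k s)

/-- `r` is a run of `X` on the complete `k`-ary tree `t`. A run on a tree labels the nodes of the
tree, together with those of its outer frontier (`k` sons below each leaf), by states, such that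
every node of `t` with its sons obeys the transition relation. So its height is one more than the
height of `t`. -/
def IsRunBelow : {h : ℕ} → CompleteTree k (Fin s) h →
    CompleteTree k (Fin X.numStates) (h + 1) → Prop
  | _, .leaf a, .node q rs => (q, a, fun i => (rs i).root) ∈ X.trans
  | _, .node a ts, .node q rs =>
      (q, a, fun i => (rs i).root) ∈ X.trans ∧ ∀ i, IsRunBelow (ts i) (rs i)

/-- `r` is a run of `X` on the almost `k`-ary tree `t`: as above, with the root (and only it) having
`k - 1` sons, also if it is a leaf of `t`. -/
def IsRun : {h : ℕ} → AlmostTree k (Fin s) h → AlmostTree k (Fin X.numStates) (h + 1) → Prop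
  | _, .leaf a, .node q rs => (q, a, fun i => (rs i).root) ∈ X.rootTrans
  | _, .node a ts, .node q rs =>
      (q, a, fun i => (rs i).root) ∈ X.rootTrans ∧ ∀ i, X.IsRunBelow (ts i) (rs i)

/-- The language of `X`: the trees with a run that starts in the initial state at the root and ends
in a final state at every node of the outer frontier. -/
def language : Set (FinAlmostTree k (Fin s)) :=
  {t | ∃ r : AlmostTree k (Fin X.numStates) (t.1 + 1),
    X.IsRun t.2 r ∧ r.root = X.start ∧ r.LeavesIn {q | q ∈ X.final}}

end AlmostTreeAutomaton

/-! ### Finite tree sequence automata -/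

/-- A finite tree sequence automaton: a Büchi automaton with states `0, …, numStates - 1` over a
finite alphabet of `numLetters` letters, each of which denotes an almost `k`-ary finite tree
automaton over the alphabet `{0, …, s - 1}`. -/
structure TreeSeqAutomaton (k s : ℕ) where
  numStates : ℕ
  start : Fin numStates
  numLetters : ℕ
  letters : Fin numLetters → AlmostTreeAutomaton k s
  trans : List (Fin numStates × Fin numLetters × Fin numStates)
  final : List (Fin numStates)

namespace TreeSeqAutomaton

variable {k s : ℕ} (A : TreeSeqAutomaton k s)

/-- `σ` is a run of `A` on the sequence `g` of almost `k`-ary finite trees. -/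
def IsRun (g : ℕ → FinAlmostTree k (Fin s)) (σ : ℕ → Fin A.numStates) : Prop :=
  σ 0 = A.start ∧
    ∀ i, ∃ b, (σ i, b, σ (i + 1)) ∈ A.trans ∧ g i ∈ (A.letters b).language

/-- The language of `A`: the sequences of almost `k`-ary finite trees with a run in which some
final state occurs infinitely often. -/
def language : Set (ℕ → FinAlmostTree k (Fin s)) :=
  {g | ∃ σ, A.IsRun g σ ∧ ∃ q ∈ A.final, ∀ n, ∃ i, n ≤ i ∧ σ i = q}

end TreeSeqAutomaton

/-! ### Instances and their encoding as words -/

/-- An instance of the emptiness problem: an arity `k ≥ 2`, the size `s` of the alphabet, and a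
finite tree sequence automaton. -/
structure Instance where
  k : ℕ
  two_le : 2 ≤ k
  s : ℕ
  aut : TreeSeqAutomaton k s

/-- A list is coded by its length followed by the codes of its entries. -/
def codeList {α : Type} (c : α → List ℕ) (l : List α) : List ℕ :=
  l.length :: l.flatMap c

/-- The code of a transition of a tree automaton: state, letter, states of the sons. -/
def codeTrans {n s m : ℕ} (t : Fin n × Fin s × (Fin m → Fin n)) : List ℕ :=
  t.1.1 :: t.2.1.1 :: List.ofFn (fun i => (t.2.2 i).1)

def AlmostTreeAutomaton.code {k s : ℕ} (X : AlmostTreeAutomaton k s) : List ℕ :=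
  [X.numStates, X.start.1] ++ (codeList codeTrans X.rootTrans ++
    (codeList codeTrans X.trans ++ codeList (fun q => [q.1]) X.final))

def TreeSeqAutomaton.code {k s : ℕ} (A : TreeSeqAutomaton k s) : List ℕ :=
  [A.numStates, A.start.1] ++ (codeList AlmostTreeAutomaton.code (List.ofFn A.letters) ++
    (codeList (fun t => [t.1.1, t.2.1.1, t.2.2.1]) A.trans ++
      codeList (fun q => [q.1]) A.final))

/-- A list of natural numbers as a word over `{0, 1, #}`: each number in binary, ended by `#`. -/
def encodeNats (l : List ℕ) : List (Option Bool) :=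
  l.flatMap fun n => (Computability.encodeNat n).map some ++ [none]

/-- The encoding of an instance as a word over `{0, 1, #}`. -/
def Instance.encode (I : Instance) : List (Option Bool) :=
  encodeNats ([I.k, I.s] ++ I.aut.code)

/-! The encoding is injective. -/

theorem encodeNats_injective : Function.Injective encodeNats := by
  have key : ∀ (u v : List Bool) (r r' : List (Option Bool)),
      u.map some ++ none :: r = v.map some ++ none :: r' → u = v ∧ r = r' := by
    intro u
    induction u with
    | nil => intro v r r' h; cases v <;> simp_all
    | cons a u ih =>
      intro v r r' h
      cases v with
      | nil => simp at h
      | cons b v =>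
        simp only [List.map_cons, List.cons_append, List.cons.injEq, Option.some.injEq] at h
        obtain ⟨h1, h2⟩ := ih v r r' h.2
        exact ⟨by rw [h.1, h1], h2⟩
  intro l
  induction l with
  | nil => intro l' h; cases l' <;> simp_all [encodeNats]
  | cons a l ih =>
    intro l' h
    cases l' with
    | nil => simp [encodeNats] at h
    | cons b l' =>
      simp only [encodeNats, List.flatMap_cons, List.append_assoc, List.singleton_append] at h
      obtain ⟨h1, h2⟩ := key _ _ _ _ h
      have h3 : a = b := by
        rw [← Computability.decode_encodeNat a, h1, Computability.decode_encodeNat]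
      rw [h3, ih h2]

theorem codeList_prefix {α : Type} {c : α → List ℕ}
    (hc : ∀ a b r r', c a ++ r = c b ++ r' → a = b ∧ r = r') :
    ∀ (l l' : List α) (r r' : List ℕ),
      codeList c l ++ r = codeList c l' ++ r' → l = l' ∧ r = r' := by
  intro l
  induction l with
  | nil => intro l' r r' h; cases l' <;> simp_all [codeList]
  | cons a l ih =>
    intro l' r r' h
    cases l' with
    | nil => simp [codeList] at h
    | cons b l' =>
      simp only [codeList, List.flatMap_cons, List.length_cons, List.cons_append,
        List.append_assoc, List.cons.injEq, Nat.add_right_cancel_iff] at h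
      obtain ⟨h1, h2⟩ := hc _ _ _ _ h.2
      obtain ⟨h3, h4⟩ := ih l' r r' (by simp [codeList, h.1, h2])
      exact ⟨by rw [h1, h3], h4⟩

theorem codeTrans_prefix {n s m : ℕ} (t t' : Fin n × Fin s × (Fin m → Fin n)) (r r' : List ℕ)
    (h : codeTrans t ++ r = codeTrans t' ++ r') : t = t' ∧ r = r' := by
  obtain ⟨q, a, p⟩ := t
  obtain ⟨q', a', p'⟩ := t'
  simp only [codeTrans, List.cons_append, List.cons.injEq] at h
  obtain ⟨h1, h2, h3⟩ := h
  obtain ⟨h4, h5⟩ := List.append_inj h3 (by simp)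
  have h6 := List.ofFn_injective h4
  refine ⟨?_, h5⟩
  have h7 : p = p' := funext fun i => Fin.ext (congrFun h6 i)
  rw [Fin.ext h1, Fin.ext h2, h7]

theorem codeFin_prefix {n : ℕ} (q q' : Fin n) (r r' : List ℕ)
    (h : [q.1] ++ r = [q'.1] ++ r') : q = q' ∧ r = r' := by
  simpa [Fin.ext_iff] using h

theorem codeTriple_prefix {n m : ℕ} (t t' : Fin n × Fin m × Fin n) (r r' : List ℕ)
    (h : [t.1.1, t.2.1.1, t.2.2.1] ++ r = [t'.1.1, t'.2.1.1, t'.2.2.1] ++ r') :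
    t = t' ∧ r = r' := by
  simpa [Fin.ext_iff, Prod.ext_iff, and_assoc] using h

theorem AlmostTreeAutomaton.code_prefix {k s : ℕ} (X Y : AlmostTreeAutomaton k s)
    (r r' : List ℕ) (h : X.code ++ r = Y.code ++ r') : X = Y ∧ r = r' := by
  obtain ⟨n, q, d, e, f⟩ := X
  obtain ⟨n', q', d', e', f'⟩ := Y
  simp only [code, List.cons_append, List.nil_append, List.append_assoc, List.cons.injEq] at h
  obtain ⟨hn, h1, h⟩ := h
  subst hn
  have h2 := codeList_prefix codeTrans_prefix _ _ _ _ h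
  have h3 := codeList_prefix codeTrans_prefix _ _ _ _ h2.2
  have h4 := codeList_prefix codeFin_prefix _ _ _ _ h3.2
  rw [Fin.ext h1, h2.1, h3.1, h4.1]
  exact ⟨rfl, h4.2⟩

theorem TreeSeqAutomaton.code_injective {k s : ℕ} :
    Function.Injective (TreeSeqAutomaton.code (k := k) (s := s)) := by
  rintro ⟨n, q, m, l, d, f⟩ ⟨n', q', m', l', d', f'⟩ h
  simp only [code, List.cons_append, List.nil_append, List.cons.injEq] at h
  obtain ⟨hn, h1, h⟩ := h
  subst hn
  have h2 := codeList_prefix AlmostTreeAutomaton.code_prefix _ _ _ _ h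
  have hm : m = m' := by simpa using congrArg List.length h2.1
  subst hm
  have h3 := codeList_prefix codeTriple_prefix _ _ _ _ h2.2
  have h4 := codeList_prefix codeFin_prefix f f' [] [] (by rw [h3.2])
  rw [Fin.ext h1, List.ofFn_injective h2.1, h3.1, h4.1]

theorem Instance.encode_injective : Function.Injective Instance.encode := by
  rintro ⟨k, hk, s, A⟩ ⟨k', hk', s', A'⟩ h
  have h := encodeNats_injective h
  simp only [List.cons_append, List.nil_append, List.cons.injEq] at h
  obtain ⟨rfl, rfl, h⟩ := h
  obtain rfl := TreeSeqAutomaton.code_injective h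
  rfl

/-! ### Doubly exponential time -/

open Classical in
/-- The decision problem `P`, with instances encoded as words by `enc`, is in 2EXPTIME: some
multi-stack (equivalently, multi-tape) Turing machine with finitely many states and finite
stack alphabets decides it in time `2 ^ 2 ^ p(n)` for some polynomial `p`, where `n` is the length
of the encoding of the instance. -/
def InTwoExpTime {α Γ : Type} (enc : α → List Γ) (P : α → Prop) : Prop :=
  ∃ (M : Turing.TM2ComputableInTime enc Computability.encodeBool (fun a => decide (P a)))
    (p : Polynomial ℕ),
    (∀ j, Finite (M.tm.Γ j)) ∧ ∀ n, M.time n ≤ 2 ^ 2 ^ p.eval n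

end TreeSeq

/-! Whether a tree automaton accepts some tree of height `h` depends only on its set of live states,
from which the levels still missing can be completed with final states on the outer frontier. For `h
= 0` these are the final states, and every further level applies one deterministic map on sets of
states (`AlmostTreeAutomaton.live`, `exists_mem_language`). The trees of an increasing sequence are
chosen independently of each other. Hence nonemptiness asks for an infinite path from the initial
state that visits some final state infinitely often, in a graph whose edges at time `i` are
determined by the live sets of all letters at height `i`.

The vector of live sets follows the orbit of a map on a finite set. Two visits to the recurring
final state with equal vectors bound a lasso. Conversely, equal vectors make the edges periodic from
there on, so a lasso can be unrolled. Pairing the vector with a set of reachable states gives a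
deterministic system on `A.Config`, and the pigeonhole principle shortens stem and loop to at most
the number of configurations (`language_inter_its_ne_empty_iff`). As numbers are written in binary,
the numbers of states and letters are only known to be below `E = 2 ^ n` for inputs of length `n`,
so there are fewer than `2 ^ (E * E)` configurations.

This bound is large enough for everything to be done in unary by brute force: sets of states are
numbers below the bound, found by exhaustive search, and time polynomial in the bound is still
doubly exponential in a polynomial of `n`. It therefore suffices to use counter programs, which a
stack machine simulates step by step (`Exec.simulate`), and the class `UPoly` of functions they
compute in time polynomial in the values of the arguments. This class is closed under pairing,
size-bounded recursion, bounded quantifiers and search, so it contains `HasLasso`. What remains is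
to read the input, with the list of its numbers coded by iterated pairing, to produce the bound by
repeated doubling, and to check that the procedure finds each part of an encoded automaton at the
position it computes. -/

namespace TreeSeq

/-! ### Counter programs -/

/-- Programs on registers that hold natural numbers, with a read-once input word. -/
inductive Prog
  | skip
  | inc (r : ℕ)
  | seq (p q : Prog)
  /-- While register `r` is not zero, decrement it and run `p`. -/
  | loop (r : ℕ) (p : Prog)
  /-- While the input is not empty, remove its first symbol (`none`, `false` or `true`) and run the
  corresponding program. -/
  | read (p q₀ q₁ : Prog)

namespace Prog

/-- The remaining input and the contents of the registers. -/
abbrev State := List (Option Bool) × (ℕ → ℕ)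

/-- `Exec p s t s'`: started in state `s`, the program `p` ends in state `s'` after `t` steps. -/
inductive Exec : Prog → State → ℕ → State → Prop
  | skip (s) : Exec skip s 1 s
  | inc (r w S) : Exec (inc r) (w, S) 1 (w, Function.update S r (S r + 1))
  | seq {p q s t s' t' s''} : Exec p s t s' → Exec q s' t' s'' → Exec (seq p q) s (t + t') s''
  | loop_zero {r p w S} : S r = 0 → Exec (loop r p) (w, S) 1 (w, S)
  | loop_succ {r p w S n t s' t' s''} : S r = n + 1 → Exec p (w, Function.update S r n) t s' →
      Exec (loop r p) s' t' s'' → Exec (loop r p) (w, S) (1 + t + t') s''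
  | read_nil {p q₀ q₁ S} : Exec (read p q₀ q₁) ([], S) 1 ([], S)
  | read_cons {p q₀ q₁ a w S t s' t' s''} :
      Exec (match a with | none => p | some false => q₀ | some true => q₁) (w, S) t s' →
      Exec (read p q₀ q₁) s' t' s'' → Exec (read p q₀ q₁) (a :: w, S) (1 + t + t') s''

/-- All registers used by the program are at most `R`. -/
def Bounded (R : ℕ) : Prog → Prop
  | skip => True
  | inc r => r ≤ R
  | seq p q => Bounded R p ∧ Bounded R q
  | loop r p => r ≤ R ∧ Bounded R p
  | read p q₀ q₁ => Bounded R p ∧ Bounded R q₀ ∧ Bounded R q₁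

theorem Bounded.mono {R R' : ℕ} (h : R ≤ R') : ∀ {p : Prog}, p.Bounded R → p.Bounded R'
  | skip, _ => trivial
  | inc _, hp => le_trans hp h
  | seq _ _, hp => ⟨hp.1.mono h, hp.2.mono h⟩
  | loop _ _, hp => ⟨le_trans hp.1 h, hp.2.mono h⟩
  | read _ _ _, hp => ⟨hp.1.mono h, hp.2.1.mono h, hp.2.2.mono h⟩

theorem exists_bounded : ∀ p : Prog, ∃ R, p.Bounded R
  | skip => ⟨0, trivial⟩
  | inc r => ⟨r, le_rfl⟩
  | seq p q => by
    obtain ⟨R, hR⟩ := exists_bounded p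
    obtain ⟨R', hR'⟩ := exists_bounded q
    exact ⟨max R R', hR.mono (le_max_left _ _), hR'.mono (le_max_right _ _)⟩
  | loop r p => by
    obtain ⟨R, hR⟩ := exists_bounded p
    exact ⟨max R r, le_max_right _ _, hR.mono (le_max_left _ _)⟩
  | read p q₀ q₁ => by
    obtain ⟨R, hR⟩ := exists_bounded p
    obtain ⟨R₀, hR₀⟩ := exists_bounded q₀
    obtain ⟨R₁, hR₁⟩ := exists_bounded q₁
    exact ⟨max R (max R₀ R₁), hR.mono (le_max_left _ _),
      hR₀.mono (le_max_of_le_right (le_max_left _ _)),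
      hR₁.mono (le_max_of_le_right (le_max_right _ _))⟩

/-! ### Compilation into stack machines -/

/-- The stkOf of the machine for programs with registers `0, …, R`. -/
inductive Stk (R : ℕ)
  | out
  | inp
  | reg (i : Fin (R + 1))
  deriving DecidableEq, Fintype

/-- The stack alphabets. -/
def Sym {R : ℕ} : Stk R → Type
  | .out => Bool
  | .inp => Option Bool
  | .reg _ => Unit

/-- The control points of a program. -/
def Loc : Prog → Type
  | skip => Unit
  | inc _ => Unit
  | seq p q => Loc p ⊕ Loc q
  | loop _ p => Option (Loc p)
  | read p q₀ q₁ => Option (Loc p ⊕ Loc q₀ ⊕ Loc q₁)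

/-- A program has finitely many control points. -/
@[reducible] noncomputable def fintypeLoc : ∀ p : Prog, Fintype (Loc p)
  | skip => inferInstanceAs (Fintype Unit)
  | inc _ => inferInstanceAs (Fintype Unit)
  | seq p q =>
    letI := fintypeLoc p
    letI := fintypeLoc q
    inferInstanceAs (Fintype (Loc p ⊕ Loc q))
  | loop _ p =>
    letI := fintypeLoc p
    inferInstanceAs (Fintype (Option (Loc p)))
  | read p q₀ q₁ =>
    letI := fintypeLoc p
    letI := fintypeLoc q₀
    letI := fintypeLoc q₁
    inferInstanceAs (Fintype (Option (Loc p ⊕ Loc q₀ ⊕ Loc q₁)))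

/-- The control point where the execution starts. -/
def entry : ∀ p : Prog, Loc p
  | skip => ()
  | inc _ => ()
  | seq p _ => Sum.inl (entry p)
  | loop _ _ => none
  | read _ _ _ => none

/-- The internal memory of the machine: the last symbol read from a stack. -/
abbrev Mem := Option (Option Bool)

/-- The statements of the machine at the control points of a program that is part of a larger
machine: `emb` embeds its control points, and `exit` is where to go in the end. -/
def code (R : ℕ) {Λ : Type} : ∀ p : Prog, (Loc p → Λ) → Λ → Loc p →
    Turing.TM2.Stmt (Sym (R := R)) Λ Mem
  | skip, _, exit, _ => .goto fun _ => exit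
  | inc r, _, exit, _ => .push (.reg (Fin.ofNat (R + 1) r)) (fun _ => ()) (.goto fun _ => exit)
  | seq p q, emb, _, .inl l => code R p (emb ∘ Sum.inl) (emb (Sum.inr (entry q))) l
  | seq _ q, emb, exit, .inr l => code R q (emb ∘ Sum.inr) exit l
  | loop r p, emb, exit, none =>
    .pop (.reg (Fin.ofNat (R + 1) r)) (fun _ o => o.map fun _ => none)
      (.goto fun v => match v with
        | none => exit
        | some _ => emb (some (entry p)))
  | loop _ p, emb, _, some l => code R p (emb ∘ some) (emb none) l
  | read p q₀ q₁, emb, exit, none =>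
    .pop .inp (fun _ o => o)
      (.goto fun v => match v with
        | none => exit
        | some none => emb (some (.inl (entry p)))
        | some (some false) => emb (some (.inr (.inl (entry q₀))))
        | some (some true) => emb (some (.inr (.inr (entry q₁)))))
  | read p _ _, emb, _, some (.inl l) => code R p (emb ∘ some ∘ .inl) (emb none) l
  | read _ q₀ _, emb, _, some (.inr (.inl l)) =>
    code R q₀ (emb ∘ some ∘ .inr ∘ .inl) (emb none) l
  | read _ _ q₁, emb, _, some (.inr (.inr l)) =>
    code R q₁ (emb ∘ some ∘ .inr ∘ .inr) (emb none) l

/-- The stkOf that represent a state of the program. -/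
def stkOf (R : ℕ) (s : State) : ∀ j : Stk R, List (Sym j)
  | .out => ([] : List Bool)
  | .inp => s.1
  | .reg i => List.replicate (s.2 i) ()

theorem stkOf_update {R r : ℕ} (hr : r ≤ R) (w : List (Option Bool)) (S : ℕ → ℕ) (n : ℕ) :
    stkOf R (w, Function.update S r n) =
      Function.update (stkOf R (w, S)) (.reg (Fin.ofNat (R + 1) r)) (List.replicate n ()) := by
  funext j
  cases j with
  | out => rw [Function.update_of_ne (by simp)]; rfl
  | inp => rw [Function.update_of_ne (by simp)]; rfl
  | reg i =>
    by_cases h : i = Fin.ofNat (R + 1) r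
    · subst h
      rw [Function.update_self]
      simp [stkOf, Nat.mod_eq_of_lt (Nat.lt_succ_of_le hr)]
    · rw [Function.update_of_ne (by simpa using h)]
      have h' : (i : ℕ) ≠ r := by
        rintro rfl
        exact h (by simp)
      simp [stkOf, Function.update_of_ne h']

theorem stkOf_reg {R r : ℕ} (hr : r ≤ R) (s : State) :
    stkOf R s (.reg (Fin.ofNat (R + 1) r)) = List.replicate (s.2 r) () := by
  simp only [stkOf, Fin.val_ofNat, Nat.mod_eq_of_lt (Nat.lt_succ_of_le hr)]
  rfl

theorem stkOf_read {R : ℕ} (w : List (Option Bool)) (S : ℕ → ℕ) :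
    Function.update (stkOf R (w, S)) .inp (stkOf R (w, S) .inp).tail = stkOf R (w.tail, S) := by
  funext j
  cases j <;> rfl

/-- `t` steps of a machine lead from one configuration to another. -/
def Steps {C : Type} (f : C → Option C) (t : ℕ) (a b : C) : Prop :=
  (flip bind f)^[t] (some a) = some b

theorem Steps.trans {C : Type} {f : C → Option C} {t t' : ℕ} {a b c : C}
    (h : Steps f t a b) (h' : Steps f t' b c) : Steps f (t + t') a c := by
  rw [Steps, Nat.add_comm, Function.iterate_add_apply, h, h']

theorem Steps.single {C : Type} {f : C → Option C} {a b : C} (h : f a = some b) :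
    Steps f 1 a b := h

/-- A register is a stack over one symbol, so a decrement with its zero test is a single pop. Every
clause of `Exec` charges exactly the machine steps it needs, and sequencing is free, so the time
carries over unchanged. Quantifying over `emb` and `exit` allows the induction to treat a program as
part of a larger machine. -/
theorem Exec.simulate {R : ℕ} {Λ : Type} (m : Λ → Turing.TM2.Stmt (Sym (R := R)) Λ Mem)
    {p : Prog} {s s' : State} {t : ℕ} (h : Exec p s t s') : p.Bounded R →
    ∀ (emb : Loc p → Λ) (exit : Λ), (∀ l, m (emb l) = code R p emb exit l) → ∀ v, ∃ v',
      Steps (Turing.TM2.step m) t ⟨some (emb (entry p)), v, stkOf R s⟩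
        ⟨some exit, v', stkOf R s'⟩ := by
  induction h with
  | skip s =>
    intro _ emb exit hm v
    exact ⟨v, Steps.single (by simp [Turing.TM2.step, hm, code])⟩
  | inc r w S =>
    intro hp emb exit hm v
    refine ⟨v, Steps.single ?_⟩
    simp only [Turing.TM2.step, hm, code, Turing.TM2.stepAux]
    rw [stkOf_update hp, stkOf_reg hp]
    rfl
  | @seq p q s t s' t' s'' _ _ ih ih' =>
    intro hp emb exit hm v
    obtain ⟨v₁, h₁⟩ := ih hp.1 (emb ∘ Sum.inl) (emb (Sum.inr (entry q)))
      (fun l => hm (Sum.inl l)) v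
    obtain ⟨v₂, h₂⟩ := ih' hp.2 (emb ∘ Sum.inr) exit (fun l => hm (Sum.inr l)) v₁
    exact ⟨v₂, h₁.trans h₂⟩
  | @loop_zero r p w S h0 =>
    intro hp emb exit hm v
    have hm0 : m (emb (entry (loop r p))) = code R (loop r p) emb exit none := hm none
    have h1 := stkOf_update hp.1 w S 0
    rw [Function.update_eq_self_iff.2 h0.symm] at h1
    refine ⟨none, Steps.single ?_⟩
    simp only [Turing.TM2.step, hm0, code, Turing.TM2.stepAux, stkOf_reg hp.1, h0]
    exact congrArg some (congrArg (Turing.TM2.Cfg.mk _ _) h1.symm)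
  | @loop_succ r p w S n t s' t' s'' h1 _ _ ih ih' =>
    intro hp emb exit hm v
    have hm0 : m (emb (entry (loop r p))) = code R (loop r p) emb exit none := hm none
    obtain ⟨v₁, h₁⟩ := ih hp.2 (emb ∘ some) (emb none) (fun l => hm (some l)) (some none)
    obtain ⟨v₂, h₂⟩ := ih' hp emb exit hm v₁
    refine ⟨v₂, (Steps.trans (Steps.single ?_) h₁).trans h₂⟩
    simp only [Turing.TM2.step, hm0, code, Turing.TM2.stepAux, stkOf_reg hp.1, h1]
    rw [stkOf_update hp.1]
    rfl
  | @read_nil p q₀ q₁ S =>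
    intro hp emb exit hm v
    have hm0 : m (emb (entry (read p q₀ q₁))) = code R (read p q₀ q₁) emb exit none := hm none
    refine ⟨none, Steps.single ?_⟩
    simp only [Turing.TM2.step, hm0, code, Turing.TM2.stepAux, stkOf_read]
    rfl
  | @read_cons p q₀ q₁ a w S t s' t' s'' _ _ ih ih' =>
    intro hp emb exit hm v
    have hm0 : m (emb (entry (read p q₀ q₁))) = code R (read p q₀ q₁) emb exit none := hm none
    -- The three branches differ only in the control point entered after the pop; the return to the
    -- head of the loop is common.
    suffices h : ∃ l, (∃ v', Steps (Turing.TM2.step m) t ⟨some l, some a, stkOf R (w, S)⟩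
          ⟨some (emb none), v', stkOf R s'⟩) ∧ Turing.TM2.step m
          ⟨some (emb (entry (read p q₀ q₁))), v, stkOf R (a :: w, S)⟩ =
            some ⟨some l, some a, stkOf R (w, S)⟩ by
      obtain ⟨l, ⟨v₁, h₁⟩, hl⟩ := h
      obtain ⟨v₂, h₂⟩ := ih' hp emb exit hm v₁
      exact ⟨v₂, (Steps.trans (Steps.single hl) h₁).trans h₂⟩
    simp only [Turing.TM2.step, hm0, code, Turing.TM2.stepAux, stkOf_read]
    match a, ih with
    | none, ih =>
      exact ⟨_, ih hp.1 (emb ∘ some ∘ .inl) (emb none) (fun l => hm (some (.inl l))) _, rfl⟩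
    | some false, ih =>
      exact ⟨_, ih hp.2.1 (emb ∘ some ∘ .inr ∘ .inl) (emb none)
        (fun l => hm (some (.inr (.inl l)))) _, rfl⟩
    | some true, ih =>
      exact ⟨_, ih hp.2.2 (emb ∘ some ∘ .inr ∘ .inr) (emb none)
        (fun l => hm (some (.inr (.inr l)))) _, rfl⟩

/-- The machine that runs the program and outputs whether register `0` is not zero. -/
noncomputable def machine (R : ℕ) (p : Prog) : Turing.FinTM2 where
  K := Stk R
  k₀ := .inp
  k₁ := .out
  Γ := Sym
  Λ := Option (Loc p)
  main := some (entry p)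
  ΛFin := letI := fintypeLoc p; inferInstance
  σ := Mem
  initialState := none
  Γk₀Fin := inferInstanceAs (Fintype (Option Bool))
  m
    | some l => code R p some none l
    | none => .pop (.reg 0) (fun _ o => o.map fun _ => none)
        (.push .out (fun v => v.isSome) (.load (fun _ => none) .halt))

/-- A halting configuration must have all stacks empty except the output. This is why programs have
to consume the input and clear every register but the answer. The extra step moves the answer to the
output stack and resets the memory. -/
theorem machine_outputs {R : ℕ} {p : Prog} (hp : p.Bounded R) {w : List (Option Bool)} {b : Bool}
    {t : ℕ} (h : Exec p (w, fun _ => 0) t ([], Function.update (fun _ => 0) 0 b.toNat)) :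
    (flip bind (machine R p).step)^[t + 1] (some (Turing.initList (machine R p) w)) =
      some (Turing.haltList (machine R p) [b]) := by
  obtain ⟨v, hv⟩ := h.simulate (machine R p).m hp some none (fun _ => rfl) none
  have h0 : Turing.initList (machine R p) w =
      ⟨some (some (entry p)), none, stkOf R (w, fun _ => 0)⟩ := by
    unfold Turing.initList
    congr 1
    funext j
    cases j <;> rfl
  rw [h0]
  refine hv.trans (Steps.single ?_)
  simp only [Turing.TM2.step, machine, Turing.TM2.stepAux, Turing.haltList]
  congr 2
  funext j
  cases j with
  | out => cases b <;> rfl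
  | inp => rfl
  | reg i =>
    by_cases hi : i = 0
    · subst hi
      cases b <;> rfl
    · rw [Function.update_of_ne (by simp), Function.update_of_ne (by simpa using hi)]
      simp [stkOf, hi]

end Prog
end TreeSeq

namespace TreeSeq

/-! ### Polynomial bounds -/

/-- `f` is bounded by a polynomial in `T`. -/
def Bdd {ι : Type} (T f : ι → ℕ) : Prop := ∃ c, ∀ i, f i ≤ (T i + 2) ^ c

namespace Bdd

variable {ι : Type} {T f g : ι → ℕ}

theorem mono (hg : Bdd T g) (h : ∀ i, f i ≤ g i) : Bdd T f := by
  obtain ⟨c, hc⟩ := hg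
  exact ⟨c, fun i => (h i).trans (hc i)⟩

theorem self : Bdd T T := ⟨1, fun i => by simp⟩

theorem const (n : ℕ) : Bdd T fun _ => n :=
  ⟨n, fun i => Nat.lt_two_pow_self.le.trans (Nat.pow_le_pow_left (by omega) n)⟩

theorem mul (hf : Bdd T f) (hg : Bdd T g) : Bdd T fun i => f i * g i := by
  obtain ⟨c, hc⟩ := hf
  obtain ⟨d, hd⟩ := hg
  exact ⟨c + d, fun i => by rw [pow_add]; exact Nat.mul_le_mul (hc i) (hd i)⟩

theorem pow (hf : Bdd T f) (n : ℕ) : Bdd T fun i => f i ^ n := by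
  induction n with
  | zero => exact (const 1).mono fun i => by simp
  | succ n ih => exact (ih.mul hf).mono fun i => by rw [pow_succ]

/-- The base `T i + 2` is at least `2`, so doubling the larger of the two powers costs only one more
in the exponent. -/
theorem add (hf : Bdd T f) (hg : Bdd T g) : Bdd T fun i => f i + g i := by
  refine ((hf.mul (const 1)).mono fun i => by simp : Bdd T f).elim fun c hc => ?_
  obtain ⟨d, hd⟩ := hg
  refine ⟨max c d + 1, fun i => ?_⟩
  have h1 := (hc i).trans (Nat.pow_le_pow_right (by omega) (le_max_left c d))
  have h2 := (hd i).trans (Nat.pow_le_pow_right (n := T i + 2) (by omega) (le_max_right c d))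
  calc f i + g i ≤ (T i + 2) ^ max c d * 2 := by omega
    _ ≤ _ := by rw [pow_succ]; exact Nat.mul_le_mul_left _ (by omega)

theorem trans {U : ι → ℕ} (hU : Bdd T U) (hf : Bdd U f) : Bdd T f := by
  obtain ⟨c, hc⟩ := hf
  exact ((hU.add (const 2)).pow c).mono hc

theorem comp {κ : Type} (hf : Bdd T f) (u : κ → ι) : Bdd (fun i => T (u i)) fun i => f (u i) := by
  obtain ⟨c, hc⟩ := hf
  exact ⟨c, fun i => hc (u i)⟩

end Bdd

/-! ### Programs on lists of registers -/

/-- The registers that hold the entries of a list, followed by zeros. -/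
def regs (l : List ℕ) : ℕ → ℕ := fun i => l.getD i 0

/-- The registers `S`, moved up to make place for the first `c` registers of `S₀`. -/
def frame (c : ℕ) (S₀ S : ℕ → ℕ) : ℕ → ℕ := fun i => if i < c then S₀ i else S (i - c)

theorem regs_append (l l' : List ℕ) : regs (l ++ l') = frame l.length (regs l) (regs l') := by
  funext i
  by_cases h : i < l.length
  · simp only [regs, frame, h, if_true, List.getD_append _ _ _ _ h]
  · simp only [regs, frame, h, if_false, List.getD_append_right _ _ _ _ (not_lt.1 h)]

theorem frame_update (c : ℕ) (S₀ S : ℕ → ℕ) (r v : ℕ) :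
    frame c S₀ (Function.update S r v) = Function.update (frame c S₀ S) (r + c) v := by
  funext i
  by_cases h : i = r + c
  · subst h
    simp [frame]
  · rw [Function.update_of_ne h]
    by_cases hi : i < c
    · simp [frame, hi]
    · simp only [frame, hi, if_false]
      rw [Function.update_of_ne (by omega)]

theorem frame_add (c : ℕ) (S₀ S : ℕ → ℕ) (r : ℕ) : frame c S₀ S (r + c) = S r := by
  simp [frame]

theorem update_regs {l : List ℕ} {i : ℕ} (h : i < l.length) (v : ℕ) :
    Function.update (regs l) i v = regs (l.set i v) := by
  funext j
  by_cases hj : j = i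
  · subst hj
    simp [regs, h]
  · rw [Function.update_of_ne hj]
    simp [regs, List.getElem?_set_ne (Ne.symm hj)]

theorem regs_append_zero (l : List ℕ) : regs (l ++ [0]) = regs l := by
  funext i
  rcases lt_trichotomy i l.length with h | h | h
  · simp [regs, List.getElem?_append_left h]
  · subst h
    simp [regs]
  · simp [regs, List.getElem?_append_right h.le, List.getElem?_eq_none h.le,
      Nat.sub_ne_zero_of_lt h]

/-! ### Relocation of registers and elementary loops -/

namespace Prog

/-- Move all the registers of a program up. -/
def shift (c : ℕ) : Prog → Prog
  | skip => skip
  | inc r => inc (r + c)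
  | seq p q => seq (shift c p) (shift c q)
  | loop r p => loop (r + c) (shift c p)
  | read p q₀ q₁ => read (shift c p) (shift c q₀) (shift c q₁)

/-- A frame rule: a relocated program never touches the registers below `c`, so their contents are
arbitrary and survive. -/
theorem Exec.shift {p : Prog} {s s' : State} {t : ℕ} (h : Exec p s t s') (c : ℕ) (S₀ : ℕ → ℕ) :
    Exec (p.shift c) (s.1, frame c S₀ s.2) t (s'.1, frame c S₀ s'.2) := by
  induction h with
  | skip s => exact .skip _
  | inc r w S =>
    rw [frame_update, ← frame_add c S₀ S r]
    exact .inc _ _ _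
  | seq _ _ ih ih' => exact .seq ih ih'
  | loop_zero h0 => exact .loop_zero ((frame_add c S₀ _ _).trans h0)
  | loop_succ h1 _ _ ih ih' =>
    rw [frame_update] at ih
    exact .loop_succ ((frame_add c S₀ _ _).trans h1) ih ih'
  | read_nil => exact .read_nil
  | @read_cons p q₀ q₁ a w S t s' t' s'' _ _ ih ih' =>
    refine .read_cons (s' := (s'.1, frame c S₀ s'.2)) ?_ ih'
    rcases a with _ | _ | _ <;> exact ih

theorem Exec.congr {p : Prog} {s : State} {w : List (Option Bool)} {S S' : ℕ → ℕ} {t t' : ℕ}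
    (h : Exec p s t (w, S)) (ht : t = t') (hS : S = S') : Exec p s t' (w, S') := by
  rwa [← ht, ← hS]

theorem exec_loop_skip (r : ℕ) (w : List (Option Bool)) (S : ℕ → ℕ) :
    Exec (loop r skip) (w, S) (2 * S r + 1) (w, Function.update S r 0) := by
  obtain ⟨n, hn⟩ : ∃ n, S r = n := ⟨_, rfl⟩
  induction n generalizing S with
  | zero =>
    refine (Exec.loop_zero hn).congr (by rw [hn]) ?_
    funext x
    grind [Function.update_apply]
  | succ n ih =>
    refine (Exec.loop_succ hn (.skip _) (ih (Function.update S r n) (by simp))).congr ?_ ?_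
    · grind
    · funext x
      grind [Function.update_apply]

theorem exec_loop_inc {r r' : ℕ} (h : r ≠ r') (w : List (Option Bool)) (S : ℕ → ℕ) :
    Exec (loop r (inc r')) (w, S) (2 * S r + 1)
      (w, Function.update (Function.update S r 0) r' (S r' + S r)) := by
  obtain ⟨n, hn⟩ : ∃ n, S r = n := ⟨_, rfl⟩
  induction n generalizing S with
  | zero =>
    refine (Exec.loop_zero hn).congr (by rw [hn]) ?_
    funext x
    grind [Function.update_apply]
  | succ n ih =>
    refine (Exec.loop_succ hn (.inc _ _ _) (ih _ ?_)).congr ?_ ?_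
    · grind [Function.update_apply]
    · grind [Function.update_apply]
    · funext x
      grind [Function.update_apply]

theorem exec_loop_inc_inc {r r' r'' : ℕ} (h : r ≠ r') (h' : r ≠ r'') (h'' : r' ≠ r'')
    (w : List (Option Bool)) (S : ℕ → ℕ) :
    Exec (loop r (seq (inc r') (inc r''))) (w, S) (3 * S r + 1)
      (w, Function.update (Function.update (Function.update S r 0) r' (S r' + S r)) r''
        (S r'' + S r)) := by
  obtain ⟨n, hn⟩ : ∃ n, S r = n := ⟨_, rfl⟩
  induction n generalizing S with
  | zero =>
    refine (Exec.loop_zero hn).congr (by rw [hn]) ?_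
    funext x
    grind [Function.update_apply]
  | succ n ih =>
    refine (Exec.loop_succ hn (.seq (.inc _ _ _) (.inc _ _ _)) (ih _ ?_)).congr ?_ ?_
    · grind [Function.update_apply]
    · grind [Function.update_apply]
    · funext x
      grind [Function.update_apply]

/-- Add register `i` to register `j`, by means of the auxiliary register `u`. -/
def addTo (i j u : ℕ) : Prog := seq (loop i (seq (inc j) (inc u))) (loop u (inc i))

theorem exec_addTo {i j u : ℕ} (h : i ≠ j) (h' : i ≠ u) (h'' : j ≠ u)
    (w : List (Option Bool)) {S : ℕ → ℕ} (hu : S u = 0) :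
    Exec (addTo i j u) (w, S) (5 * S i + 2) (w, Function.update S j (S j + S i)) := by
  refine ((exec_loop_inc_inc h h' h'' w S).seq (exec_loop_inc h'.symm w _)).congr ?_ ?_
  · grind [Function.update_apply]
  · funext x
    grind [Function.update_apply]

end Prog

open Prog

/-- Some program leads from the registers `u i` to the registers `v i`, for all `i`, in time
polynomial in `T i`. -/
def Real {ι : Type} (T : ι → ℕ) (u v : ι → List ℕ) : Prop :=
  ∃ p : Prog, ∃ t : ι → ℕ, Bdd T t ∧
    ∀ i w, ∃ t' ≤ t i, Exec p (w, regs (u i)) t' (w, regs (v i))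

namespace Real

variable {ι : Type} {T : ι → ℕ} {u v x y : ι → List ℕ}

theorem refl (u : ι → List ℕ) : Real T u u :=
  ⟨.skip, fun _ => 1, .const 1, fun _ _ => ⟨1, le_rfl, .skip _⟩⟩

theorem trans (h : Real T u v) (h' : Real T v x) : Real T u x := by
  obtain ⟨p, t, ht, hp⟩ := h
  obtain ⟨q, t', ht', hq⟩ := h'
  refine ⟨.seq p q, fun i => t i + t' i, ht.add ht', fun i w => ?_⟩
  obtain ⟨n, hn, h1⟩ := hp i w
  obtain ⟨n', hn', h2⟩ := hq i w
  exact ⟨n + n', add_le_add hn hn', h1.seq h2⟩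

theorem of_bdd {U : ι → ℕ} (h : Real U u v) (hU : Bdd T U) : Real T u v := by
  obtain ⟨p, t, ht, hp⟩ := h
  exact ⟨p, t, hU.trans ht, hp⟩

theorem comp {κ : Type} (h : Real T u v) (f : κ → ι) :
    Real (fun i => T (f i)) (fun i => u (f i)) fun i => v (f i) := by
  obtain ⟨p, t, ht, hp⟩ := h
  exact ⟨p, fun i => t (f i), ht.comp f, fun i w => hp (f i) w⟩

/-- The length of the untouched prefix must not depend on `i`, because one and the same relocated
program serves all `i`. -/
theorem append_left {n : ℕ} (hx : ∀ i, (x i).length = n) (h : Real T u v) :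
    Real T (fun i => x i ++ u i) fun i => x i ++ v i := by
  obtain ⟨p, t, ht, hp⟩ := h
  refine ⟨p.shift n, t, ht, fun i w => ?_⟩
  obtain ⟨k, hk, he⟩ := hp i w
  refine ⟨k, hk, ?_⟩
  rw [regs_append, regs_append, hx]
  exact he.shift n _

theorem append_zero (u : ι → List ℕ) : Real T u fun i => u i ++ [0] :=
  ⟨.skip, fun _ => 1, .const 1, fun i _ => ⟨1, le_rfl, by rw [regs_append_zero]; exact .skip _⟩⟩

theorem inc_head (n : ι → ℕ) : Real T (fun i => n i :: u i) fun i => (n i + 1) :: u i := by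
  refine ⟨.inc 0, fun _ => 1, .const 1, fun i w => ⟨1, le_rfl, ?_⟩⟩
  have := Exec.inc 0 w (regs (n i :: u i))
  rw [update_regs (by simp)] at this
  simpa [regs] using this

theorem le_sum_of_getD (l : List ℕ) (i : ℕ) : l.getD i 0 ≤ l.sum := by
  by_cases h : i < l.length
  · rw [List.getD_eq_getElem _ _ h]
    exact List.le_sum_of_mem (List.getElem_mem h)
  · simp [List.getElem?_eq_none (not_lt.1 h)]

/-- Reading a register destroys it. The two zero registers past the end of the list are used for
this: one receives the copy, the other restores the original and is cleared again. -/
theorem push {n j : ℕ} (hu : ∀ i, (u i).length = n) (hj : j < n) (hb : Bdd T fun i => (u i).sum) :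
    Real T u fun i => u i ++ [(u i).getD j 0] := by
  refine ⟨addTo j n (n + 1), fun i => 5 * (u i).sum + 2, ((Bdd.const 5).mul hb).add (.const 2),
    fun i w => ⟨5 * (u i).getD j 0 + 2, ?_, ?_⟩⟩
  · have := le_sum_of_getD (u i) j
    show _ ≤ 5 * (u i).sum + 2
    omega
  · have h0 : regs (u i) n = 0 := by simp [regs, ← hu i]
    have h1 : regs (u i) (n + 1) = 0 := by simp [regs, ← hu i]
    have := exec_addTo (by omega) (by omega) (by omega) w h1 (i := j) (j := n)
    rw [h0, zero_add] at this
    refine this.congr rfl ?_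
    rw [← regs_append_zero (u i), update_regs (by simp [hu]), ← hu i,
      List.set_append_right _ _ le_rfl, regs_append_zero]
    simp [regs]

/-- The list with the first entry zero, moved down to the second entry. -/
theorem move_down {n : ℕ} (hu : ∀ i, (u i).length = n) (hb : Bdd T fun i => (u i).sum) :
    Real T (fun i => 0 :: u i) u := by
  induction n generalizing u with
  | zero =>
    have : u = fun _ => [] := by
      funext i
      exact List.length_eq_zero_iff.1 (hu i)
    subst this
    refine ⟨.skip, fun _ => 1, .const 1, fun i _ => ⟨1, le_rfl, ?_⟩⟩
    have := regs_append_zero []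
    rw [List.nil_append] at this
    simp only [this]
    exact .skip _
  | succ n ih =>
    have hu' : ∀ i, u i = (u i).headD 0 :: (u i).tail := by
      intro i
      have := hu i
      cases h : u i with
      | nil => simp [h] at this
      | cons => rfl
    have hl : ∀ i, (u i).tail.length = n := fun i => by simp [hu]
    have hs : ∀ i, (u i).sum = (u i).headD 0 + (u i).tail.sum := fun i => by
      conv_lhs => rw [hu' i, List.sum_cons]
    have h1 := append_left (x := fun i => [(u i).headD 0]) (n := 1) (fun i => rfl)
      (ih hl (hb.mono fun i => by rw [hs]; omega))
    simp only [List.cons_append, List.nil_append, ← hu'] at h1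
    refine trans ?_ h1
    -- Moving the head into the vacated register leaves a zero just before the tail, which is the
    -- situation of the induction hypothesis.
    refine ⟨.loop 1 (.inc 0), fun i => 2 * (u i).sum + 1,
      ((Bdd.const 2).mul hb).add (.const 1), fun i w => ?_⟩
    have h2 := exec_loop_inc (r := 1) (r' := 0) (by omega) w (regs (0 :: u i))
    have h3 : regs (0 :: u i) 1 = (u i).headD 0 := by
      rw [hu' i]
      rfl
    rw [update_regs (by simp [hu]), update_regs (by simp [hu]), h3] at h2
    refine ⟨2 * (u i).headD 0 + 1, ?_, ?_⟩
    · have := hs i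
      show _ ≤ 2 * (u i).sum + 1
      omega
    · convert h2 using 3
      rw [hu' i]
      simp [regs]

theorem tail {n : ℕ} {m : ι → ℕ} (hu : ∀ i, (u i).length = n) (hb : Bdd T fun i => (u i).sum)
    (hm : Bdd T m) : Real T (fun i => m i :: u i) u := by
  refine trans ?_ (move_down hu hb)
  refine ⟨.loop 0 .skip, fun i => 2 * m i + 1, ((Bdd.const 2).mul hm).add (.const 1),
    fun i w => ⟨_, le_rfl, ?_⟩⟩
  have := exec_loop_skip 0 w (regs (m i :: u i))
  rw [update_regs (by simp)] at this
  exact this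

theorem drop {m n : ℕ} (hx : ∀ i, (x i).length = m) (hu : ∀ i, (u i).length = n)
    (hxb : Bdd T fun i => (x i).sum) (hub : Bdd T fun i => (u i).sum) :
    Real T (fun i => x i ++ u i) u := by
  induction m generalizing x with
  | zero =>
    have : x = fun _ => [] := by
      funext i
      exact List.length_eq_zero_iff.1 (hx i)
    subst this
    exact refl u
  | succ m ih =>
    have hx' : ∀ i, x i = (x i).headD 0 :: (x i).tail := by
      intro i
      have := hx i
      cases h : x i with
      | nil => simp [h] at this
      | cons => rfl
    have hs : ∀ i, (x i).sum = (x i).headD 0 + (x i).tail.sum := fun i => by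
      conv_lhs => rw [hx' i, List.sum_cons]
    have hb : Bdd T fun i => (x i).tail.sum := hxb.mono fun i => by rw [hs]; omega
    refine trans ?_ (ih (x := fun i => (x i).tail) (fun i => by simp [hx]) hb)
    have := tail (T := T) (u := fun i => (x i).tail ++ u i) (m := fun i => (x i).headD 0)
      (n := m + n) (fun i => by simp [hx, hu])
      ((hb.add hub).mono fun i => by simp) (hxb.mono fun i => by rw [hs]; omega)
    simpa only [← List.cons_append, ← hx'] using this

theorem push_map {n : ℕ} (idx : List ℕ) (hidx : ∀ j ∈ idx, j < n) (hu : ∀ i, (u i).length = n)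
    (hub : Bdd T fun i => (u i).sum) :
    Real T u (fun i => u i ++ idx.map fun j => (u i).getD j 0) := by
  induction idx using List.reverseRecOn with
  | nil => simpa using refl u
  | append_singleton idx j ih =>
    refine trans (ih fun j hj => hidx j (by simp [hj])) ?_
    have hs : Bdd T fun i => (u i ++ idx.map fun j => (u i).getD j 0).sum := by
      refine (hub.add ((Bdd.const idx.length).mul hub)).mono fun i => ?_
      rw [List.sum_append]
      refine Nat.add_le_add_left ?_ _
      have := List.sum_le_card_nsmul (idx.map fun j => (u i).getD j 0) (u i).sum (by
        intro a ha
        obtain ⟨j, _, rfl⟩ := List.mem_map.1 ha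
        exact le_sum_of_getD _ _)
      simpa using this
    have hj : j < n := hidx j (by simp)
    have := push (T := T) (n := n + idx.length) (j := j) (fun i => by simp [hu]) (by omega) hs
    convert this using 2 with i
    rw [List.map_append, List.append_assoc, List.getD_append _ _ _ _ (hj.trans_eq (hu i).symm)]
    rfl

theorem select {n : ℕ} (idx : List ℕ) (hidx : ∀ j ∈ idx, j < n) (hu : ∀ i, (u i).length = n)
    (hub : Bdd T fun i => (u i).sum) : Real T u (fun i => idx.map fun j => (u i).getD j 0) := by
  refine trans (push_map idx hidx hu hub) (drop hu (n := idx.length) (by simp) hub ?_)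
  refine ((Bdd.const idx.length).mul hub).mono fun i => ?_
  have := List.sum_le_card_nsmul (idx.map fun j => (u i).getD j 0) (u i).sum (by
    intro a ha
    obtain ⟨j, _, rfl⟩ := List.mem_map.1 ha
    exact le_sum_of_getD _ _)
  simpa using this

/-- The body is indexed by pairs `(i, j)` with `j < n i`, so it has to work only on the states that
really occur, but with one time bound polynomial in `T i` for all rounds. The counter sits in
register `0`, below the relocated body, and its empty register is removed at the end. -/
theorem loop {n : ι → ℕ} {s : ι → ℕ → List ℕ} {m : ℕ}
    (h : Real (ι := {p : ι × ℕ // p.2 < n p.1}) (fun p => T p.1.1) (fun p => s p.1.1 p.1.2)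
      fun p => s p.1.1 (p.1.2 + 1))
    (hs : ∀ i, (s i (n i)).length = m) (hn : Bdd T n) (hb : Bdd T fun i => (s i (n i)).sum) :
    Real T (fun i => n i :: s i 0) fun i => s i (n i) := by
  refine trans ?_ (move_down hs hb)
  obtain ⟨p, t, ⟨c, hc⟩, hp⟩ := h
  refine ⟨.loop 0 (p.shift 1), fun i => n i * (1 + (T i + 2) ^ c) + 1,
    (hn.mul ((Bdd.const 1).add ⟨c, fun _ => le_rfl⟩)).add (.const 1), fun i w => ?_⟩
  -- When `k` rounds are left, `n i - k` have been completed; this turns the upward iteration into a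
  -- countdown.
  suffices H : ∀ k ≤ n i, ∃ t' ≤ k * (1 + (T i + 2) ^ c) + 1, Exec (.loop 0 (p.shift 1))
      (w, regs (k :: s i (n i - k))) t' (w, regs (0 :: s i (n i))) by
    simpa using H (n i) le_rfl
  intro k
  induction k with
  | zero => exact fun _ => ⟨1, by simp, .loop_zero rfl⟩
  | succ k ih =>
    intro hk
    obtain ⟨t', ht', he⟩ := ih (by omega)
    obtain ⟨t₁, ht₁, he₁⟩ := hp ⟨(i, n i - (k + 1)), show n i - (k + 1) < n i by omega⟩ w
    refine ⟨1 + t₁ + t', ?_, .loop_succ (n := k) rfl (s' := (w, regs (k :: s i (n i - k)))) ?_ he⟩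
    · have := ht₁.trans (hc _)
      simp only at this
      calc 1 + t₁ + t' ≤ 1 + (T i + 2) ^ c + (k * (1 + (T i + 2) ^ c) + 1) := by omega
        _ = _ := by ring
    · rw [update_regs (by simp), List.set_cons_zero]
      have h2 := he₁.shift 1 (regs [k])
      simp only at h2
      rw [show n i - (k + 1) + 1 = n i - k by omega] at h2
      have e : ∀ l, frame 1 (regs [k]) (regs l) = regs (k :: l) := fun l =>
        (regs_append [k] l).symm
      simpa only [e] using h2

end Real

end TreeSeq

namespace TreeSeq

/-! ### Functions computable in polynomial time, with numbers in unary -/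

/-- Types of tuples of a fixed number of natural numbers. -/
class Tup (α : Type) where
  len : ℕ
  enc : α → List ℕ
  length_enc : ∀ a, (enc a).length = len

open Tup

instance : Tup ℕ := ⟨1, fun n => [n], fun _ => rfl⟩

instance {α β : Type} [Tup α] [Tup β] : Tup (α × β) :=
  ⟨len α + len β, fun p => enc p.1 ++ enc p.2, fun p => by simp [length_enc]⟩

open Classical in
noncomputable instance : Tup Prop := ⟨1, fun p => [if p then 1 else 0], fun _ => rfl⟩

/-- The sum of the entries of a tuple. -/
def size {α : Type} [Tup α] (a : α) : ℕ := (enc a).sum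

@[simp] theorem size_nat (n : ℕ) : size n = n := by simp [size, enc]

@[simp] theorem size_prod {α β : Type} [Tup α] [Tup β] (p : α × β) :
    size p = size p.1 + size p.2 := by simp [size, enc]

theorem size_prop_le (p : Prop) : size p ≤ 1 := by
  by_cases h : p <;> simp [size, enc, h]

/-- `f` is computed by a program in time polynomial in the entries of the argument. -/
@[fun_prop]
def UPoly {α β : Type} [Tup α] [Tup β] (f : α → β) : Prop :=
  Bdd (size (α := α)) (fun a => size (f a)) ∧ Real (size (α := α)) enc fun a => enc (f a)

theorem Real.const {ι : Type} {T : ι → ℕ} (l : List ℕ) : Real T (fun _ => []) fun _ => l := by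
  induction l using List.reverseRecOn with
  | nil => exact .refl _
  | append_singleton l c ih =>
    refine ih.trans ?_
    have h : Real T (fun _ => []) fun _ => [c] := by
      induction c with
      | zero => exact .append_zero _
      | succ c ihc => exact ihc.trans (.inc_head (u := fun _ => []) fun _ => c)
    simpa using h.append_left (x := fun _ => l) (fun _ => rfl)

theorem map_getD_range (l l' : List ℕ) :
    ((List.range l.length).map fun j => (l ++ l').getD j 0) = l := by
  refine List.ext_getElem (by simp) fun i h _ => ?_
  have : i < l.length := by simpa using h
  simp [List.getElem?_append_left this, this]

/-! ### Closure properties of computability in unary polynomial time -/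

namespace UPoly

variable {α β γ : Type} [Tup α] [Tup β] [Tup γ]

theorem congr {f g : α → β} (hf : UPoly f) (h : ∀ a, enc (g a) = enc (f a)) : UPoly g := by
  obtain ⟨h1, h2⟩ := hf
  constructor
  · exact h1.mono fun i => by rw [size, h]; rfl
  · simpa only [h] using h2

@[fun_prop]
theorem id' : UPoly fun a : α => a := ⟨.self, .refl _⟩

@[fun_prop]
theorem const' (b : β) : UPoly fun _ : α => b := by
  refine ⟨.const _, .trans (v := fun _ => []) ?_ (.const _)⟩
  simpa using Real.select (T := size) (u := enc) [] (by simp) (length_enc (α := α)) .self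

@[fun_prop]
theorem comp' {g : β → γ} {f : α → β} (hg : UPoly g) (hf : UPoly f) : UPoly fun a => g (f a) :=
  ⟨hf.1.trans (hg.1.comp f), hf.2.trans ((hg.2.comp f).of_bdd hf.1)⟩

theorem fst : UPoly fun p : α × β => p.1 := by
  refine ⟨Bdd.self.mono fun p => by simp, ?_⟩
  have := Real.select (T := size (α := α × β)) (u := enc) (List.range (len α))
    (n := len α + len β) (fun j hj => by have := List.mem_range.1 hj; omega)
    (length_enc (α := α × β)) .self
  convert this using 2 with p
  rw [← map_getD_range (enc p.1) (enc p.2), length_enc]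
  simp [enc]

theorem snd : UPoly fun p : α × β => p.2 := by
  refine ⟨Bdd.self.mono fun p => by simp, ?_⟩
  exact Real.drop (x := fun p : α × β => enc p.1) (fun p => length_enc p.1)
    (fun p => length_enc p.2) (Bdd.self.mono fun p => by simp [size, enc])
    (Bdd.self.mono fun p => by simp [size, enc])

@[fun_prop]
theorem fst' {f : α → β × γ} (hf : UPoly f) : UPoly fun a => (f a).1 := fst.comp' hf

@[fun_prop]
theorem snd' {f : α → β × γ} (hf : UPoly f) : UPoly fun a => (f a).2 := snd.comp' hf

-- A program replaces its argument by its value, so `f` and `g` each work on a fresh copy of `a`,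
-- and the original is dropped at the end.
@[fun_prop]
theorem pair {f : α → β} {g : α → γ} (hf : UPoly f) (hg : UPoly g) :
    UPoly fun a => (f a, g a) := by
  have h0 : Real (size (α := α)) (fun a => enc a) fun a => enc a ++ enc a := by
    have := Real.push_map (T := size (α := α)) (u := enc) (List.range (len α))
      (n := len α) (fun j hj => List.mem_range.1 hj) length_enc .self
    convert this using 3 with a
    have := map_getD_range (enc a) []
    rw [List.append_nil, length_enc] at this
    exact this.symm
  have h1 : Real (size (α := α)) (fun a => enc a ++ enc (f a))
      fun a => enc a ++ enc (f a) ++ enc a := by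
    have := Real.push_map (T := size (α := α)) (u := fun a => enc a ++ enc (f a))
      (List.range (len α)) (n := len α + len β)
      (fun j hj => by have := List.mem_range.1 hj; omega) (fun a => by simp [length_enc])
      ((Bdd.self.add hf.1).mono fun a => by simp [size])
    convert this using 3 with a
    have := map_getD_range (enc a) (enc (f a))
    rw [length_enc] at this
    exact this.symm
  have h2 := hg.2.append_left (x := fun a => enc a ++ enc (f a)) (n := len α + len β)
    (fun a => by simp [length_enc])
  refine ⟨(hf.1.add hg.1).mono fun a => by simp,
    ((h0.trans (hf.2.append_left (fun a => length_enc a))).trans (h1.trans h2)).trans ?_⟩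
  have := Real.drop (T := size (α := α)) (x := fun a => enc a) (u := fun a => enc (f a, g a))
    (m := len α) (n := len β + len γ) (fun a => length_enc a) (fun a => length_enc (f a, g a)) .self
    ((hf.1.add hg.1).mono fun a => by simp [size, enc])
  simpa [enc] using this

@[fun_prop]
theorem succ {f : α → ℕ} (hf : UPoly f) : UPoly fun a => f a + 1 := by
  refine comp' (g := fun n : ℕ => n + 1) ⟨?_, ?_⟩ hf
  · exact (Bdd.self.add (.const 1)).mono fun n => by simp
  · exact Real.inc_head (u := fun _ => []) fun n => n

/-- Recursion whose values have polynomial size. -/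
theorem natRec {n : α → ℕ} {h : α → β} {g : α → ℕ → β → β} (hn : UPoly n) (hh : UPoly h)
    (hg : UPoly fun x : α × ℕ × β => g x.1 x.2.1 x.2.2)
    (hb : ∃ T : α → ℕ, Bdd (size (α := α)) T ∧ ∀ a, ∀ i ≤ n a,
      size (Nat.rec (h a) (g a) i : β) ≤ T a) :
    UPoly fun a => (Nat.rec (h a) (g a) (n a) : β) := by
  obtain ⟨T, hT, hTb⟩ := hb
  have hn' : Bdd (size (α := α)) n := hn.1.mono fun a => by simp
  set r : α → ℕ → β := fun a i => Nat.rec (h a) (g a) i with hr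
  refine ⟨hT.mono fun a => hTb a _ le_rfl, ?_⟩
  have hbody : UPoly fun x : α × ℕ × β => (x.1, x.2.1 + 1, g x.1 x.2.1 x.2.2) := by fun_prop
  have hinit : UPoly fun a => (n a, a, 0, h a) := by fun_prop
  have hlast : UPoly fun x : α × ℕ × β => x.2.2 := by fun_prop
  have hbd : Bdd (size (α := α)) fun a => size (a, n a, r a (n a)) :=
    (Bdd.self.add (hn'.add hT)).mono fun a => by
      simp only [size_prod, size_nat]
      have := hTb a (n a) le_rfl
      change size (r a (n a)) ≤ _ at this
      omega
  -- The state of the loop carries the parameter, the index and the current value. The bound `T` on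
  -- all intermediate values is what keeps every round, not only the result, polynomial in `size a`.
  refine (hinit.2.trans (Real.loop (n := n) (s := fun a i => enc (a, i, r a i))
    (m := len α + (1 + len β)) ?_ (fun a => length_enc _) hn' hbd)).trans
    ((hlast.2.comp fun a => (a, n a, r a (n a))).of_bdd hbd)
  have h1 := hbody.2.comp fun p : {p : α × ℕ // p.2 < n p.1} =>
    (p.1.1, p.1.2, r p.1.1 p.1.2)
  refine h1.of_bdd ?_
  refine ((Bdd.self.add (hn'.add hT)).comp fun p : {p : α × ℕ // p.2 < n p.1} => p.1.1).mono ?_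
  rintro ⟨⟨a, i⟩, hi⟩
  have := hTb a i (le_of_lt hi)
  change size (r a i) ≤ _ at this
  simp only [size_prod, size_nat] at hi ⊢
  omega

open Classical in
theorem ofNat {f : α → ℕ} {P : α → Prop} (hf : UPoly f) (h : ∀ a, f a = if P a then 1 else 0) :
    UPoly P :=
  hf.congr fun a => by rw [h a]

open Classical in
@[fun_prop]
theorem ind {P : α → Prop} (hP : UPoly P) : UPoly fun a => if P a then (1 : ℕ) else 0 :=
  hP.congr fun _ => rfl

-- A conditional is a recursion of length `0` or `1`: zero rounds keep `g a`, one round overwrites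
-- it with `f a`.
@[fun_prop]
theorem ite {P : α → Prop} [∀ a, Decidable (P a)] {f g : α → β} (hP : UPoly P) (hf : UPoly f) (hg : UPoly g) :
    UPoly fun a => if P a then f a else g a := by
  have key : ∀ a, ∀ i ≤ 1, (Nat.rec (g a) (fun _ _ => f a) i : β) = if i = 1 then f a else g a := by
    intro a i hi
    interval_cases i <;> rfl
  have := natRec (g := fun a _ _ => f a) hP.ind hg (by fun_prop) ⟨fun a => size (f a) + size (g a),
    hf.1.add hg.1, fun a i hi => by
      rw [key a i (hi.trans (by split_ifs <;> omega))]
      show _ ≤ size (f a) + size (g a)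
      split_ifs <;> omega⟩
  refine this.congr fun a => ?_
  by_cases h : P a <;> simp [h]

@[fun_prop]
theorem not {P : α → Prop} (hP : UPoly P) : UPoly fun a => ¬ P a := by
  classical
  refine ofNat (hP.ite (const' 0) (const' 1)) fun a => ?_
  by_cases h : P a <;> simp [h]

@[fun_prop]
theorem and {P Q : α → Prop} (hP : UPoly P) (hQ : UPoly Q) : UPoly fun a => P a ∧ Q a := by
  classical
  refine ofNat (hP.ite hQ.ind (const' 0)) fun a => ?_
  by_cases h : P a <;> simp [h]

@[fun_prop]
theorem or {P Q : α → Prop} (hP : UPoly P) (hQ : UPoly Q) : UPoly fun a => P a ∨ Q a := by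
  classical
  refine ofNat (hP.ite (const' 1) hQ.ind) fun a => ?_
  by_cases h : P a <;> simp [h]

@[fun_prop]
theorem imp {P Q : α → Prop} (hP : UPoly P) (hQ : UPoly Q) : UPoly fun a => P a → Q a :=
  (hP.not.or hQ).congr fun a => by congr 1; exact propext imp_iff_not_or

@[fun_prop]
theorem iff {P Q : α → Prop} (hP : UPoly P) (hQ : UPoly Q) : UPoly fun a => P a ↔ Q a :=
  ((hP.imp hQ).and (hQ.imp hP)).congr fun a => by congr 1; exact propext iff_iff_implies_and_implies

@[fun_prop]
theorem add {f g : α → ℕ} (hf : UPoly f) (hg : UPoly g) : UPoly fun a => f a + g a := by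
  have key : ∀ a i, (Nat.rec (f a) (fun _ r => r + 1) i : ℕ) = f a + i := fun a i => by
    induction i with
    | zero => rfl
    | succ i ih => simp only [ih]; omega
  refine (natRec (g := fun _ _ r => r + 1) hg hf (by fun_prop)
    ⟨fun a => size (f a) + size (g a), hf.1.add hg.1, fun a i hi => ?_⟩).congr fun a => ?_
  · simpa [key] using hi
  · rw [key]

@[fun_prop]
theorem mul {f g : α → ℕ} (hf : UPoly f) (hg : UPoly g) : UPoly fun a => f a * g a := by
  have key : ∀ a i, (Nat.rec 0 (fun _ r => r + f a) i : ℕ) = f a * i := fun a i => by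
    induction i with
    | zero => rfl
    | succ i ih => simp only [ih]; ring
  refine (natRec (g := fun a _ r => r + f a) hg (const' 0) (by fun_prop)
    ⟨fun a => size (f a) * size (g a), hf.1.mul hg.1, fun a i hi => ?_⟩).congr fun a => ?_
  · simpa [key] using Nat.mul_le_mul_left _ hi
  · rw [key]

/-- A recursion that discards the previous value and returns its index ends with the index of the
last round. -/
theorem pred {f : α → ℕ} (hf : UPoly f) : UPoly fun a => f a - 1 := by
  have key : ∀ i, (Nat.rec 0 (fun i _ => i) i : ℕ) = i - 1 := fun i => by cases i <;> rfl
  refine (natRec (g := fun _ i _ => i) hf (const' 0) (by fun_prop)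
    ⟨fun a => size (f a), hf.1, fun a i hi => ?_⟩).congr fun a => ?_
  · simp only [key, size_nat]
    omega
  · rw [key]

@[fun_prop]
theorem sub {f g : α → ℕ} (hf : UPoly f) (hg : UPoly g) : UPoly fun a => f a - g a := by
  have key : ∀ a i, (Nat.rec (f a) (fun _ r => r - 1) i : ℕ) = f a - i := fun a i => by
    induction i with
    | zero => rfl
    | succ i ih => simp only [ih]; omega
  refine (natRec (g := fun _ _ r => r - 1) hg hf (pred (by fun_prop))
    ⟨fun a => size (f a), hf.1, fun a i hi => ?_⟩).congr fun a => ?_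
  · simp [key]
  · rw [key]

@[fun_prop]
theorem lt {f g : α → ℕ} (hf : UPoly f) (hg : UPoly g) : UPoly fun a => f a < g a := by
  classical
  refine ofNat (f := fun a => (1 : ℕ) - (1 - (g a - f a))) (by fun_prop) fun a => ?_
  split_ifs <;> omega

@[fun_prop]
theorem le {f g : α → ℕ} (hf : UPoly f) (hg : UPoly g) : UPoly fun a => f a ≤ g a :=
  (hg.lt hf).not.congr fun a => by simp

@[fun_prop]
theorem eq {f g : α → ℕ} (hf : UPoly f) (hg : UPoly g) : UPoly fun a => f a = g a :=
  ((hf.le hg).and (hg.le hf)).congr fun a => by congr 1; exact propext le_antisymm_iff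

-- Testing all `i < n a` takes `n a` rounds, which is polynomial because numbers count by their
-- value. The accumulator is a truth value, hence of size at most `1`.
@[fun_prop]
theorem exists_lt {n : α → ℕ} {P : α → ℕ → Prop} (hn : UPoly n)
    (hP : UPoly fun x : α × ℕ => P x.1 x.2) : UPoly fun a => ∃ i < n a, P a i := by
  have hg : UPoly fun x : α × ℕ × Prop => x.2.2 ∨ P x.1 x.2.1 :=
    or (by fun_prop) (hP.comp' (f := fun x : α × ℕ × Prop => (x.1, x.2.1)) (by fun_prop))
  refine (natRec (g := fun a i r => r ∨ P a i) hn (const' False) hg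
    ⟨fun _ => 1, .const 1, fun a i _ => size_prop_le _⟩).congr fun a => ?_
  congr 1
  generalize n a = k
  refine propext ?_
  induction k with
  | zero => simp
  | succ k ih => simp only [Nat.exists_lt_succ_right, ih]

@[fun_prop]
theorem forall_lt {n : α → ℕ} {P : α → ℕ → Prop} (hn : UPoly n)
    (hP : UPoly fun x : α × ℕ => P x.1 x.2) : UPoly fun a => ∀ i < n a, P a i :=
  (exists_lt (P := fun a i => ¬ P a i) hn hP.not).not.congr fun a => by simp

end UPoly

open Classical in
/-- A number `i < n` with `P i`, or `0` if there is none. -/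
noncomputable def search (n : ℕ) (P : ℕ → Prop) : ℕ :=
  Nat.rec 0 (fun i r => if P i then i else r) n

theorem search_le (n : ℕ) (P : ℕ → Prop) : search n P ≤ n := by
  induction n with
  | zero => exact le_rfl
  | succ n ih =>
    simp only [search] at ih ⊢
    split_ifs <;> omega

theorem search_spec {n : ℕ} {P : ℕ → Prop} (h : ∃ i < n, P i) : P (search n P) := by
  induction n with
  | zero => simp at h
  | succ n ih =>
    simp only [search] at ih ⊢
    split_ifs with hn
    · exact hn
    · rw [Nat.exists_lt_succ_right] at h
      exact ih (h.resolve_right hn)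

theorem search_eq {n m : ℕ} {P : ℕ → Prop} (hm : m < n) (h : ∀ i, P i ↔ i = m) :
    search n P = m :=
  (h _).1 (search_spec ⟨m, hm, (h m).2 rfl⟩)

@[fun_prop]
theorem UPoly.search {α : Type} [Tup α] {n : α → ℕ} {P : α → ℕ → Prop} (hn : UPoly n)
    (hP : UPoly fun x : α × ℕ => P x.1 x.2) : UPoly fun a => TreeSeq.search (n a) (P a) := by
  classical
  have hg : UPoly fun x : α × ℕ × ℕ => if P x.1 x.2.1 then x.2.1 else x.2.2 :=
    ite (hP.comp' (f := fun x : α × ℕ × ℕ => (x.1, x.2.1)) (by fun_prop)) (by fun_prop)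
      (by fun_prop)
  exact natRec (g := fun a i r => if P a i then i else r) hn (const' 0) hg
    ⟨fun a => size (n a), hn.1, fun a i hi => by
      simpa [TreeSeq.search] using (search_le i (P a)).trans hi⟩

@[fun_prop]
theorem UPoly.div_two {α : Type} [Tup α] {f : α → ℕ} (hf : UPoly f) : UPoly fun a => f a / 2 := by
  have : UPoly fun a => TreeSeq.search (f a + 1) fun i => f a = 2 * i ∨ f a = 2 * i + 1 := by
    fun_prop
  refine this.congr fun a => ?_
  rw [search_eq (m := f a / 2)] <;> omega

@[fun_prop]
theorem UPoly.testBit {α : Type} [Tup α] {f g : α → ℕ} (hf : UPoly f) (hg : UPoly g) :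
    UPoly fun a => (f a).testBit (g a) = true := by
  have key : ∀ a i, (Nat.rec (f a) (fun _ r => r / 2) i : ℕ) = f a / 2 ^ i := fun a i => by
    induction i with
    | zero => simp
    | succ i ih => simp only [ih, Nat.div_div_eq_div_mul, pow_succ]
  have h : UPoly fun a => f a / 2 ^ g a := by
    refine (natRec (g := fun _ _ r => r / 2) hg hf (by fun_prop)
      ⟨fun a => size (f a), hf.1, fun a i hi => ?_⟩).congr fun a => ?_
    · simpa [key] using Nat.div_le_self _ _
    · rw [key]
  -- Oddness of the shifted number, expressed by halving alone.
  have h' : UPoly fun a => f a / 2 ^ g a = 2 * (f a / 2 ^ g a / 2) + 1 := by fun_prop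
  refine h'.congr fun a => ?_
  congr 1
  rw [Nat.testBit_eq_decide_div_mod_eq, decide_eq_true_eq]
  exact propext (by omega)

@[fun_prop]
theorem UPoly.natPair {α : Type} [Tup α] {f g : α → ℕ} (hf : UPoly f) (hg : UPoly g) :
    UPoly fun a => Nat.pair (f a) (g a) := by
  classical
  have : UPoly fun a => if f a < g a then g a * g a + f a else f a * f a + f a + g a := by fun_prop
  exact this.congr fun a => by simp [Nat.pair]

@[fun_prop]
theorem UPoly.unpair_fst {α : Type} [Tup α] {f : α → ℕ} (hf : UPoly f) :
    UPoly fun a => (f a).unpair.1 := by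
  have : UPoly fun a => TreeSeq.search (f a + 1) fun i => ∃ j < f a + 1, Nat.pair i j = f a := by
    fun_prop
  refine this.congr fun a => ?_
  rw [search_eq (m := (f a).unpair.1) (Nat.lt_succ_of_le (Nat.unpair_left_le _))]
  refine fun i => ⟨?_, ?_⟩
  · rintro ⟨j, _, h⟩
    rw [← h, Nat.unpair_pair]
  · rintro rfl
    exact ⟨_, Nat.lt_succ_of_le (Nat.unpair_right_le _), Nat.pair_unpair _⟩

@[fun_prop]
theorem UPoly.unpair_snd {α : Type} [Tup α] {f : α → ℕ} (hf : UPoly f) :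
    UPoly fun a => (f a).unpair.2 := by
  have : UPoly fun a => TreeSeq.search (f a + 1) fun j => ∃ i < f a + 1, Nat.pair i j = f a := by
    fun_prop
  refine this.congr fun a => ?_
  rw [search_eq (m := (f a).unpair.2) (Nat.lt_succ_of_le (Nat.unpair_right_le _))]
  refine fun i => ⟨?_, ?_⟩
  · rintro ⟨j, _, h⟩
    rw [← h, Nat.unpair_pair]
  · rintro rfl
    exact ⟨_, Nat.lt_succ_of_le (Nat.unpair_left_le _), Nat.pair_unpair _⟩

end TreeSeq

namespace TreeSeq

open Tup

/-! ### The decision procedure -/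

/-- The number less than `B` whose binary digits `1` are at the positions `q` with `P q`. -/
noncomputable def bitset (B : ℕ) (P : ℕ → Prop) : ℕ :=
  search B fun S => ∀ q < B, S.testBit q = true ↔ P q

-- The search tries up to `n a` candidate numbers and compares up to `n a` bits of each, which is
-- polynomial in the value of `n a`.
@[fun_prop]
theorem UPoly.bitset {α : Type} [Tup α] {n : α → ℕ} {P : α → ℕ → Prop} (hn : UPoly n)
    (hP : UPoly fun x : α × ℕ => P x.1 x.2) : UPoly fun a => TreeSeq.bitset (n a) (P a) := by
  have h : UPoly fun x : (α × ℕ) × ℕ => P x.1.1 x.2 :=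
    hP.comp' (f := fun x : (α × ℕ) × ℕ => (x.1.1, x.2)) (by fun_prop)
  unfold TreeSeq.bitset
  fun_prop

/-- The data of the procedure: a bound on all the numbers that occur, the code of the list
of input numbers in reverse order, and the length of this list. -/
abbrev Data := ℕ × ℕ × ℕ

/-- The code of a list of numbers. -/
def listCode (l : List ℕ) : ℕ := l.foldr Nat.pair 0

/-- The entry at position `j` of the list with code `L`. -/
def nthCode (L j : ℕ) : ℕ := (Nat.rec L (fun _ r => r.unpair.2) j : ℕ).unpair.1

/-- The input number at position `j`. -/
def tok (c : Data) (j : ℕ) : ℕ := nthCode c.2.1 (c.2.2 - 1 - j)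

/-- The arity. -/
def arity (c : Data) : ℕ := tok c 0

/-! The parts of a tree automaton whose code starts at position `o`: number of transitions at the
root, position and number of the other transitions, position and number of the final states,
position after the code. -/

def numRoot (c : Data) (o : ℕ) : ℕ := tok c (o + 2)

/-- Three numbers precede the root transitions: the number of states, the initial state and the
length of the list. A root transition occupies `arity c + 1` places: state, letter and `arity c - 1`
sons. An ordinary transition, as used in `posFinal`, needs one place more. -/
def posTrans (c : Data) (o : ℕ) : ℕ := o + 3 + numRoot c o * (arity c + 1)

def numTrans (c : Data) (o : ℕ) : ℕ := tok c (posTrans c o)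

def posFinal (c : Data) (o : ℕ) : ℕ := posTrans c o + 1 + numTrans c o * (arity c + 2)

def numFinal (c : Data) (o : ℕ) : ℕ := tok c (posFinal c o)

def posNext (c : Data) (o : ℕ) : ℕ := posFinal c o + 1 + numFinal c o

/-- The position of the code of the tree automaton for letter `b`. -/
def posLetter (c : Data) (b : ℕ) : ℕ := Nat.rec 5 (fun _ o => posNext c o) b

/-- The states of the tree automaton at `o` that have a run on some complete tree of height `h - 1`
with final states at its outer frontier (for `h = 0`: the final states). -/
noncomputable def liveSet (c : Data) (o h : ℕ) : ℕ :=
  Nat.rec (bitset c.1 fun q => ∃ i < numFinal c o, tok c (posFinal c o + 1 + i) = q)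
    (fun _ S => bitset c.1 fun q => ∃ i < numTrans c o,
      tok c (posTrans c o + 1 + i * (arity c + 2)) = q ∧ ∀ j < arity c,
        S.testBit (tok c (posTrans c o + 1 + i * (arity c + 2) + (2 + j))) = true) h

/-- The tree automaton at `o` accepts a tree of height `h`. -/
def Accepts (c : Data) (o h : ℕ) : Prop :=
  ∃ i < numRoot c o, tok c (o + 3 + i * (arity c + 1)) = tok c (o + 1) ∧ ∀ j < arity c - 1,
    (liveSet c o h).testBit (tok c (o + 3 + i * (arity c + 1) + (2 + j))) = true

/-- The number of letters. -/
def numLetter (c : Data) : ℕ := tok c 4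

/-- The position of the transitions of the tree sequence automaton. -/
def posEdge (c : Data) : ℕ := posLetter c (numLetter c)

/-- The number of transitions of the tree sequence automaton. -/
def numEdge (c : Data) : ℕ := tok c (posEdge c)

/-- The position of the final states of the tree sequence automaton. -/
def posAcc (c : Data) : ℕ := posEdge c + 1 + numEdge c * 3

/-- The states of the tree sequence automaton that can be reached from `S` by reading trees of
height `x, …, x + d - 1`. -/
noncomputable def reachSet (c : Data) (S x d : ℕ) : ℕ :=
  Nat.rec S (fun i S => bitset c.1 fun q => ∃ e < numEdge c,
    tok c (posEdge c + 1 + e * 3 + 2) = q ∧ S.testBit (tok c (posEdge c + 1 + e * 3)) = true ∧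
      Accepts c (posLetter c (tok c (posEdge c + 1 + e * 3 + 1))) (x + i)) d

/-- There is an accepting lasso of size less than the bound. -/
def HasLasso (c : Data) : Prop :=
  ∃ q < c.1, (∃ i < tok c (posAcc c), tok c (posAcc c + 1 + i) = q) ∧
    ∃ x < c.1, (reachSet c (bitset c.1 fun p => p = tok c 3) 0 x).testBit q = true ∧
      ∃ d < c.1, 0 < d ∧ (∀ b < numLetter c, liveSet c (posLetter c b) x =
          liveSet c (posLetter c b) (x + d)) ∧
        (reachSet c (bitset c.1 fun p => p = q) x d).testBit q = true

/-! ### Size bounds and computability of the decision procedure -/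

theorem nthCode_iter_le (L i : ℕ) : (Nat.rec L (fun _ r => r.unpair.2) i : ℕ) ≤ L := by
  induction i with
  | zero => exact le_rfl
  | succ i ih => exact (Nat.unpair_right_le _).trans ih

theorem tok_le (c : Data) (j : ℕ) : tok c j ≤ c.2.1 :=
  (Nat.unpair_left_le _).trans (nthCode_iter_le _ _)

/-- Computability is claimed for arbitrary data, including those that encode no instance, so the
positions need an a priori polynomial bound. It rests on the fact that no entry exceeds the code of
the whole list. -/
theorem posLetter_le (c : Data) (b : ℕ) : posLetter c b ≤
    5 + b * (5 + c.2.1 * (c.2.1 + 1) + c.2.1 * (c.2.1 + 2) + c.2.1) := by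
  induction b with
  | zero => simp [posLetter]
  | succ b ih =>
    have e : posLetter c (b + 1) = posNext c (posLetter c b) := rfl
    rw [e]
    set o := posLetter c b
    have h1 : numRoot c o * (arity c + 1) ≤ c.2.1 * (c.2.1 + 1) :=
      Nat.mul_le_mul (tok_le _ _) (Nat.add_le_add_right (tok_le _ _) _)
    have h2 : numTrans c o * (arity c + 2) ≤ c.2.1 * (c.2.1 + 2) :=
      Nat.mul_le_mul (tok_le _ _) (Nat.add_le_add_right (tok_le _ _) _)
    have h3 : numFinal c o ≤ c.2.1 := tok_le _ _
    rw [posNext, posFinal, posTrans, add_mul, one_mul]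
    omega

namespace UPoly

variable {α : Type} [Tup α] {c : α → Data} {f g h : α → ℕ}

@[fun_prop]
theorem tok (hc : UPoly c) (hf : UPoly f) : UPoly fun a => tok (c a) (f a) := by
  have h : UPoly fun x : ℕ × ℕ => (Nat.rec x.1 (fun _ r => r.unpair.2) x.2 : ℕ) :=
    natRec (h := fun x : ℕ × ℕ => x.1) (g := fun _ _ r => r.unpair.2) (by fun_prop)
      (by fun_prop) (by fun_prop) ⟨size, .self, fun a i _ => by
        have := nthCode_iter_le a.1 i
        simp only [size_nat, size_prod]
        omega⟩
  exact (h.comp' (f := fun a => ((c a).2.1, (c a).2.2 - 1 - f a)) (by fun_prop)).unpair_fst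

@[fun_prop]
theorem arity (hc : UPoly c) : UPoly fun a => arity (c a) := by
  unfold TreeSeq.arity
  fun_prop

@[fun_prop]
theorem numRoot (hc : UPoly c) (hf : UPoly f) : UPoly fun a => numRoot (c a) (f a) := by
  unfold TreeSeq.numRoot
  fun_prop

@[fun_prop]
theorem posTrans (hc : UPoly c) (hf : UPoly f) : UPoly fun a => posTrans (c a) (f a) := by
  unfold TreeSeq.posTrans
  fun_prop

@[fun_prop]
theorem numTrans (hc : UPoly c) (hf : UPoly f) : UPoly fun a => numTrans (c a) (f a) := by
  unfold TreeSeq.numTrans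
  fun_prop

@[fun_prop]
theorem posFinal (hc : UPoly c) (hf : UPoly f) : UPoly fun a => posFinal (c a) (f a) := by
  unfold TreeSeq.posFinal
  fun_prop

@[fun_prop]
theorem numFinal (hc : UPoly c) (hf : UPoly f) : UPoly fun a => numFinal (c a) (f a) := by
  unfold TreeSeq.numFinal
  fun_prop

@[fun_prop]
theorem posNext (hc : UPoly c) (hf : UPoly f) : UPoly fun a => posNext (c a) (f a) := by
  unfold TreeSeq.posNext
  fun_prop

@[fun_prop]
theorem posLetter (hc : UPoly c) (hf : UPoly f) : UPoly fun a => posLetter (c a) (f a) := by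
  have hK : UPoly fun x : Data × ℕ => 5 + x.2 * (5 + x.1.2.1 * (x.1.2.1 + 1) +
      x.1.2.1 * (x.1.2.1 + 2) + x.1.2.1) := by
    fun_prop
  have hg : UPoly fun x : (Data × ℕ) × ℕ × ℕ => TreeSeq.posNext x.1.1 x.2.2 := by fun_prop
  have h : UPoly fun x : Data × ℕ => TreeSeq.posLetter x.1 x.2 := by
    unfold TreeSeq.posLetter
    refine natRec (n := fun x : Data × ℕ => x.2) (h := fun _ => 5)
      (g := fun x _ o => TreeSeq.posNext x.1 o) (by fun_prop) (by fun_prop) hg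
      ⟨_, hK.1, fun a i hi => ?_⟩
    rw [size_nat, size_nat]
    exact (posLetter_le a.1 i).trans (Nat.add_le_add_left (Nat.mul_le_mul_right _ hi) _)
  exact h.comp' (f := fun a => (c a, f a)) (hc.pair hf)

@[fun_prop]
theorem liveSet (hc : UPoly c) (hf : UPoly f) (hg : UPoly g) :
    UPoly fun a => liveSet (c a) (f a) (g a) := by
  have h : UPoly fun x : Data × ℕ × ℕ => TreeSeq.liveSet x.1 x.2.1 x.2.2 := by
    unfold TreeSeq.liveSet
    refine natRec (by fun_prop)
      (h := fun x : Data × ℕ × ℕ => TreeSeq.bitset x.1.1 fun q =>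
        ∃ i < TreeSeq.numFinal x.1 x.2.1, TreeSeq.tok x.1 (TreeSeq.posFinal x.1 x.2.1 + 1 + i) = q)
      (by fun_prop) (g := fun (x : Data × ℕ × ℕ) _ S => TreeSeq.bitset x.1.1 fun q =>
        ∃ i < TreeSeq.numTrans x.1 x.2.1,
          TreeSeq.tok x.1 (TreeSeq.posTrans x.1 x.2.1 + 1 + i * (TreeSeq.arity x.1 + 2)) = q ∧
          ∀ j < TreeSeq.arity x.1, S.testBit (TreeSeq.tok x.1
            (TreeSeq.posTrans x.1 x.2.1 + 1 + i * (TreeSeq.arity x.1 + 2) + (2 + j))) = true)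
      (by fun_prop) ⟨size, .self, fun a i _ => ?_⟩
    simp only [size_nat, size_prod]
    cases i <;> exact (search_le _ _).trans (by omega)
  exact h.comp' (f := fun a => (c a, f a, g a)) (hc.pair (hf.pair hg))

@[fun_prop]
theorem accepts (hc : UPoly c) (hf : UPoly f) (hg : UPoly g) :
    UPoly fun a => Accepts (c a) (f a) (g a) := by
  unfold Accepts
  fun_prop

@[fun_prop]
theorem numLetter (hc : UPoly c) : UPoly fun a => numLetter (c a) := by
  unfold TreeSeq.numLetter
  fun_prop

@[fun_prop]
theorem posEdge (hc : UPoly c) : UPoly fun a => posEdge (c a) := by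
  unfold TreeSeq.posEdge
  fun_prop

@[fun_prop]
theorem numEdge (hc : UPoly c) : UPoly fun a => numEdge (c a) := by
  unfold TreeSeq.numEdge
  fun_prop

@[fun_prop]
theorem posAcc (hc : UPoly c) : UPoly fun a => posAcc (c a) := by
  unfold TreeSeq.posAcc
  fun_prop

@[fun_prop]
theorem reachSet (hc : UPoly c) (hf : UPoly f) (hg : UPoly g) (hh : UPoly h) :
    UPoly fun a => reachSet (c a) (f a) (g a) (h a) := by
  have h' : UPoly fun x : Data × ℕ × ℕ × ℕ => TreeSeq.reachSet x.1 x.2.1 x.2.2.1 x.2.2.2 := by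
    unfold TreeSeq.reachSet
    refine natRec (by fun_prop) (h := fun x : Data × ℕ × ℕ × ℕ => x.2.1) (by fun_prop)
      (g := fun (x : Data × ℕ × ℕ × ℕ) i S => TreeSeq.bitset x.1.1 fun q =>
        ∃ e < TreeSeq.numEdge x.1, TreeSeq.tok x.1 (TreeSeq.posEdge x.1 + 1 + e * 3 + 2) = q ∧
          S.testBit (TreeSeq.tok x.1 (TreeSeq.posEdge x.1 + 1 + e * 3)) = true ∧
          Accepts x.1 (TreeSeq.posLetter x.1
            (TreeSeq.tok x.1 (TreeSeq.posEdge x.1 + 1 + e * 3 + 1))) (x.2.2.1 + i))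
      (by fun_prop) ⟨size, .self, fun a i _ => ?_⟩
    simp only [size_nat, size_prod]
    cases i with
    | zero => exact (Nat.le_add_right _ _).trans (Nat.le_add_left _ _)
    | succ i => exact (search_le _ _).trans (by omega)
  exact h'.comp' (f := fun a => (c a, f a, g a, h a)) (hc.pair (hf.pair (hg.pair hh)))

theorem hasLasso : UPoly HasLasso := by
  unfold HasLasso
  fun_prop

end UPoly

end TreeSeq

namespace TreeSeq

open Tup Prog

/-! ### Reading the input -/

/-- The state while the input is read: the code of the list of the numbers read so far (in reverse
order), the length of this list, the value of the digits of the current number read so far, the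
value of its next digit, and the power of two with the number of symbols read as its exponent. -/
abbrev ReadState := ℕ × ℕ × ℕ × ℕ × ℕ

def readStep (s : ReadState) : Option Bool → ReadState
  | none => (Nat.pair s.2.2.1 s.1, s.2.1 + 1, 0, 1, 2 * s.2.2.2.2)
  | some false => (s.1, s.2.1, s.2.2.1, 2 * s.2.2.2.1, 2 * s.2.2.2.2)
  | some true => (s.1, s.2.1, s.2.2.1 + s.2.2.2.1, 2 * s.2.2.2.1, 2 * s.2.2.2.2)

def readState (w : List (Option Bool)) : ReadState := w.foldl readStep (0, 0, 0, 1, 1)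

/-- The data for the decision procedure. -/
def dataOf (w : List (Option Bool)) : Data :=
  (2 ^ ((readState w).2.2.2.2 * (readState w).2.2.2.2), (readState w).1, (readState w).2.1)

theorem readState_pow (w : List (Option Bool)) : (readState w).2.2.2.2 = 2 ^ w.length := by
  induction w using List.reverseRecOn with
  | nil => rfl
  | append_singleton w a ih =>
    rw [readState, List.foldl_append] at *
    rw [List.length_append, List.length_singleton, pow_succ, ← ih, mul_comm]
    rcases a with _ | _ | _ <;> rfl

/-- One pairing at most squares the bound on the list code, and squaring `2 ^ 2 ^ m` gives `2 ^ 2 ^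
(m + 1)`: each symbol read pays for one pairing. The number being read stays below its digit weight,
hence below `2 ^ w.length`. -/
theorem readState_bounds (w : List (Option Bool)) :
    (readState w).1 + 1 ≤ 2 ^ 2 ^ w.length ∧ (readState w).2.1 ≤ w.length ∧
      (readState w).2.2.1 + 1 ≤ (readState w).2.2.2.1 ∧
      (readState w).2.2.2.1 ≤ 2 ^ w.length := by
  induction w using List.reverseRecOn with
  | nil => simp [readState]
  | append_singleton w a ih =>
    have e : readState (w ++ [a]) = readStep (readState w) a := by
      simp [readState, List.foldl_append]
    rw [e, List.length_append, List.length_singleton]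
    obtain ⟨h1, h2, h3, h4⟩ := ih
    have h5 : 2 ^ (w.length + 1) = 2 * 2 ^ w.length := by rw [pow_succ, mul_comm]
    have h6 : 2 ^ 2 ^ (w.length + 1) = (2 ^ 2 ^ w.length) ^ 2 := by rw [← pow_mul, pow_succ]
    have h7 : 2 ^ w.length ≤ 2 ^ 2 ^ w.length :=
      Nat.pow_le_pow_right (by omega) Nat.lt_two_pow_self.le
    have h8 : 2 ^ 2 ^ w.length ≤ 2 ^ 2 ^ (w.length + 1) :=
      Nat.pow_le_pow_right (by omega) (Nat.pow_le_pow_right (by omega) (by omega))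
    have h9 : 0 < 2 ^ w.length := by positivity
    rcases a with _ | _ | _
    · refine ⟨?_, ?_, ?_, ?_⟩
      · rw [h6]
        refine (Nat.succ_le_of_lt (Nat.pair_lt_max_add_one_sq _ _)).trans ?_
        refine Nat.pow_le_pow_left ?_ 2
        have := max_le (show (readState w).2.2.1 ≤ 2 ^ 2 ^ w.length - 1 by omega)
          (show (readState w).1 ≤ 2 ^ 2 ^ w.length - 1 by omega)
        omega
      · exact Nat.add_le_add_right h2 1
      · simp [readStep]
      · exact Nat.one_le_two_pow
    all_goals simp only [readStep]; omega

theorem size_readState_le (w : List (Option Bool)) :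
    size (readState w) ≤ 5 * 2 ^ 2 ^ w.length := by
  have h := readState_bounds w
  have h' := readState_pow w
  have h1 : 2 ^ w.length ≤ 2 ^ 2 ^ w.length :=
    Nat.pow_le_pow_right (by omega) Nat.lt_two_pow_self.le
  have h2 : w.length < 2 ^ w.length := Nat.lt_two_pow_self
  simp only [size_prod, size_nat]
  omega

/-- The reading loop performs a left fold. `K` bounds the time of one round only at the states
reached from prefixes of the actual word, where size bounds are known. -/
theorem exec_read {β : Type} [Tup β] {p q₀ q₁ : Prog} {f : β → Option Bool → β} {K : ℕ} :
    ∀ (w : List (Option Bool)) (s : β), (∀ w₁ a w₂, w = w₁ ++ a :: w₂ → ∃ t ≤ K,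
      Exec (match a with | none => p | some false => q₀ | some true => q₁)
        (w₂, regs (enc (w₁.foldl f s))) t (w₂, regs (enc (f (w₁.foldl f s) a)))) →
    ∃ t ≤ w.length * (1 + K) + 1,
      Exec (.read p q₀ q₁) (w, regs (enc s)) t ([], regs (enc (w.foldl f s))) := by
  intro w
  induction w with
  | nil => exact fun s _ => ⟨1, by simp, .read_nil⟩
  | cons a w ih =>
    intro s h
    obtain ⟨t, ht, he⟩ := h [] a w rfl
    obtain ⟨t', ht', he'⟩ := ih (f s a) fun w₁ b w₂ hw => by
      simpa using h (a :: w₁) b w₂ (by rw [hw]; rfl)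
    refine ⟨1 + t + t', ?_, .read_cons he he'⟩
    rw [List.length_cons, add_mul, one_mul]
    omega

/-- The time scale of the decision procedure. -/
def scale (w : List (Option Bool)) : ℕ := 2 ^ 2 ^ (2 * w.length)

theorem le_scale (w : List (Option Bool)) : 2 ^ 2 ^ w.length ≤ scale w :=
  Nat.pow_le_pow_right (by omega) (Nat.pow_le_pow_right (by omega) (by omega))

theorem length_le_scale (w : List (Option Bool)) : w.length ≤ scale w :=
  (Nat.lt_two_pow_self.trans Nat.lt_two_pow_self).le.trans (le_scale w)

theorem exists_exec_read : ∃ p : Prog, ∃ t : List (Option Bool) → ℕ, Bdd scale t ∧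
    ∀ w, ∃ t' ≤ t w, Exec p (w, fun _ => 0) t' ([], regs (enc (readState w))) := by
  have h (a : Option Bool) : UPoly fun s : ReadState => readStep s a := by
    rcases a with _ | _ | _ <;> (unfold readStep; fun_prop)
  choose p t ht hp using fun a => (h a).2
  obtain ⟨p₀, t₀, ht₀, hp₀⟩ := Real.const (T := scale) (enc ((0, 0, 0, 1, 1) : ReadState))
  choose c hc using ht
  refine ⟨.seq p₀ (.read (p none) (p (some false)) (p (some true))),
    fun w => t₀ w + (w.length * (1 + ((5 * scale w + 2) ^ c none + (5 * scale w + 2) ^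
      c (some false) + (5 * scale w + 2) ^ c (some true))) + 1), ?_, fun w => ?_⟩
  · have h1 (n : ℕ) : Bdd scale fun w => (5 * scale w + 2) ^ n :=
      (((Bdd.const 5).mul .self).add (.const 2)).pow n
    exact ht₀.add (((Bdd.self.mono length_le_scale).mul ((Bdd.const 1).add
      (((h1 _).add (h1 _)).add (h1 _)))).add (.const 1))
  · obtain ⟨n, hn, he⟩ := hp₀ w w
    obtain ⟨n', hn', he'⟩ := exec_read (p := p none) (q₀ := p (some false)) (q₁ := p (some true))
      (K := (5 * scale w + 2) ^ c none + (5 * scale w + 2) ^ c (some false) +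
        (5 * scale w + 2) ^ c (some true)) (f := readStep) w (0, 0, 0, 1, 1) (by
      intro w₁ a w₂ hw
      obtain ⟨k, hk, hke⟩ := hp a (readState w₁) w₂
      have h2 : size (readState w₁) ≤ 5 * scale w := by
        refine (size_readState_le w₁).trans (Nat.mul_le_mul_left 5 ?_)
        refine le_trans (Nat.pow_le_pow_right (by omega) (Nat.pow_le_pow_right (by omega) ?_))
          (le_scale w)
        rw [hw, List.length_append]
        omega
      have h3 := (hk.trans (hc a _)).trans (Nat.pow_le_pow_left (Nat.add_le_add_right h2 2) (c a))
      refine ⟨k, h3.trans ?_, ?_⟩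
      · rcases a with _ | _ | _ <;> omega
      · rcases a with _ | _ | _ <;> exact hke)
    exact ⟨n + n', add_le_add hn hn', he.seq he'⟩

/-! ### From the read state to a doubly exponential time bound -/

theorem two_pow_le_scale {w : List (Option Bool)} {j : ℕ}
    (h : j ≤ (readState w).2.2.2.2 * (readState w).2.2.2.2) : 2 ^ j ≤ scale w := by
  refine Nat.pow_le_pow_right (by omega) (h.trans ?_)
  rw [readState_pow, two_mul, pow_add]

/-- The bound `2 ^ (E * E)` with `E = 2 ^ w.length` is produced by `E * E` doublings. Its size is
not polynomial in the read state, so `UPoly.natRec` does not apply; the loop is measured against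
`scale w`, which dominates all the intermediate powers. -/
theorem real_dataOf :
    Real scale (fun w => enc (readState w)) fun w => enc (HasLasso (dataOf w)) := by
  set n : List (Option Bool) → ℕ := fun w => (readState w).2.2.2.2 * (readState w).2.2.2.2 with hn
  have hs : Bdd scale fun w => size (readState w) :=
    ((Bdd.const 5).mul .self).mono fun w =>
      (size_readState_le w).trans (Nat.mul_le_mul_left 5 (le_scale w))
  have h1 : UPoly fun s : ReadState => (s.2.2.2.2 * s.2.2.2.2, 1, s) := by fun_prop
  have h2 : UPoly fun x : ℕ × ReadState => (2 * x.1, x.2) := by fun_prop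
  have h3 : UPoly fun x : ℕ × ReadState => HasLasso (x.1, x.2.1, x.2.2.1) :=
    UPoly.hasLasso.comp' (by fun_prop)
  have hb : Bdd scale fun w => size (2 ^ n w, readState w) :=
    ((Bdd.self.mono fun w => two_pow_le_scale le_rfl).add hs).mono fun w => by
      simp only [size_prod, size_nat, hn]
      exact le_rfl
  have hnb : Bdd scale n := Bdd.self.mono fun w =>
    Nat.lt_two_pow_self.le.trans (two_pow_le_scale le_rfl)
  refine ((h1.2.comp readState).of_bdd hs).trans ((Real.loop (n := n)
    (s := fun w j => enc (2 ^ j, readState w)) (m := 6) ?_ (fun _ => rfl) hnb hb).trans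
    ((h3.2.comp fun w => (2 ^ n w, readState w)).of_bdd hb))
  have h4 := h2.2.comp fun p : {p : List (Option Bool) × ℕ // p.2 < n p.1} =>
    (2 ^ p.1.2, readState p.1.1)
  simp only [← pow_succ'] at h4
  refine h4.of_bdd (((Bdd.self.add hs).comp fun p : {p : List (Option Bool) × ℕ // p.2 < n p.1} =>
    p.1.1).mono ?_)
  rintro ⟨⟨w, j⟩, hj⟩
  have := two_pow_le_scale (w := w) (j := j) (le_of_lt hj)
  simp only [size_prod, size_nat]
  omega

/-- A power of a doubly exponential number is again doubly exponential: the exponent `c` is at most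
`2 ^ c`, which adds `c` at the top level, and the summand `2` is absorbed by a factor `4`. -/
theorem scale_pow_le (w : List (Option Bool)) (c : ℕ) :
    (scale w + 2) ^ c ≤ 2 ^ 2 ^ (2 * w.length + (c + 2)) := by
  have h1 : scale w + 2 ≤ 2 ^ (2 ^ (2 * w.length) + 2) := by
    have : 0 < scale w := by unfold scale; positivity
    rw [pow_add, ← scale]
    omega
  refine (Nat.pow_le_pow_left h1 c).trans ?_
  rw [← pow_mul]
  refine Nat.pow_le_pow_right (by omega) ?_
  have h2 : c ≤ 2 ^ c := Nat.lt_two_pow_self.le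
  have h3 : 2 ^ (2 * w.length) + 2 ≤ 2 ^ (2 * w.length) * 2 ^ 2 := by
    have : 0 < 2 ^ (2 * w.length) := by positivity
    omega
  calc _ ≤ 2 ^ (2 * w.length) * 2 ^ 2 * 2 ^ c := Nat.mul_le_mul h3 h2
    _ = _ := by rw [pow_add, pow_add]; ring

theorem inTwoExpTime_of_hasLasso {α : Type} {enc : α → List (Option Bool)} {P : α → Prop}
    (h : ∀ a, P a ↔ HasLasso (dataOf (enc a))) : InTwoExpTime enc P := by
  classical
  obtain ⟨p, t, ht, hp⟩ := exists_exec_read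
  obtain ⟨q, t', ht', hq⟩ := real_dataOf
  obtain ⟨c, hc⟩ := (ht.add ht').add (.const 1)
  obtain ⟨R, hR⟩ := exists_bounded (.seq p q)
  have key : ∀ a, Nonempty (Turing.TM2OutputsInTime (machine R (.seq p q))
      ((enc a).map (Equiv.refl ((machine R (.seq p q)).Γ (machine R (.seq p q)).k₀)).invFun)
      (some [decide (P a)]) (2 ^ 2 ^ (2 * (enc a).length + (c + 2)))) := by
    intro a
    rw [show (enc a).map (Equiv.refl ((machine R (.seq p q)).Γ (machine R (.seq p q)).k₀)).invFun =
      enc a from List.map_id _]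
    obtain ⟨n, hn, he⟩ := hp (enc a)
    obtain ⟨n', hn', he'⟩ := hq (enc a) []
    -- Reading, deciding on the exhausted input, and one last step to output the answer.
    refine ⟨⟨⟨n + n' + 1, machine_outputs hR ((he.seq he').congr rfl ?_)⟩, ?_⟩⟩
    · funext i
      rcases i with _ | i
      · by_cases hP : P a
        · simp [regs, Tup.enc, hP, (h a).1 hP]
        · simp [regs, Tup.enc, hP, mt (h a).2 hP]
      · simp [regs, Tup.enc]
    · refine le_trans ?_ ((hc (enc a)).trans (scale_pow_le _ _))
      simp only
      omega
  refine ⟨⟨⟨machine R (.seq p q), .refl _, .refl _⟩, fun n => 2 ^ 2 ^ (2 * n + (c + 2)),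
    fun a => ?_⟩, 2 * .X + .C (c + 2), ?_, fun n => by simp⟩
  · exact (key a).some
  · rintro (_ | _ | _)
    · exact inferInstanceAs (Finite Bool)
    · exact inferInstanceAs (Finite (Option Bool))
    · exact inferInstanceAs (Finite Unit)

end TreeSeq

namespace TreeSeq

/-! ### Trees accepted by a tree automaton -/

namespace AlmostTreeAutomaton

variable {k s : ℕ} (X : AlmostTreeAutomaton k s)

/-- The states from which a transition leads to sons in `S`. -/
def liveStep (S : Set (Fin X.numStates)) : Set (Fin X.numStates) :=
  {q | ∃ t ∈ X.trans, t.1 = q ∧ ∀ i, t.2.2 i ∈ S}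

/-- The states with a run on some complete tree of height `h - 1` that has final states at the
outer frontier (for `h = 0`: the final states). -/
def live (h : ℕ) : Set (Fin X.numStates) := X.liveStep^[h] {q | q ∈ X.final}

theorem live_succ (h : ℕ) : X.live (h + 1) = X.liveStep (X.live h) :=
  Function.iterate_succ_apply' _ _ _

/-- Subtrees and their runs can be chosen separately for every son; only the states at their roots
link them to the transition above. The index is one ahead of the height because of the outer
frontier. -/
theorem mem_live_succ {h : ℕ} {q : Fin X.numStates} : q ∈ X.live (h + 1) ↔
    ∃ (t : CompleteTree k (Fin s) h) (r : CompleteTree k (Fin X.numStates) (h + 1)),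
      X.IsRunBelow t r ∧ r.root = q ∧ r.LeavesIn {q | q ∈ X.final} := by
  induction h generalizing q with
  | zero =>
    rw [live_succ]
    constructor
    · rintro ⟨⟨q, a, p⟩, ht, rfl, hp⟩
      exact ⟨.leaf a, .node q fun i => .leaf (p i), ht, rfl, hp⟩
    · rintro ⟨t, r, hr, rfl, hl⟩
      cases t with
      | leaf a =>
        cases r with
        | node q rs =>
          refine ⟨_, hr, rfl, fun i => ?_⟩
          have := hl i
          dsimp only
          cases h : rs i with
          | leaf b =>
            rw [h] at this
            exact this
  | succ h ih =>
    rw [live_succ]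
    constructor
    · rintro ⟨⟨q, a, p⟩, ht, rfl, hp⟩
      choose ts rs h1 h2 h3 using fun i => ih.1 (hp i)
      refine ⟨.node a ts, .node q rs, ⟨?_, h1⟩, rfl, h3⟩
      simp only [h2]
      exact ht
    · rintro ⟨t, r, hr, rfl, hl⟩
      cases t with
      | node a ts =>
        cases r with
        | node q rs =>
          exact ⟨_, hr.1, rfl, fun i => ih.2 ⟨ts i, rs i, hr.2 i, rfl, hl i⟩⟩

/-- Some transition at the root leads from the initial state to sons in `S`. -/
def RootInto (S : Set (Fin X.numStates)) : Prop :=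
  ∃ t ∈ X.rootTrans, t.1 = X.start ∧ ∀ i, t.2.2 i ∈ S

/-- The sons of the root are roots of complete trees of height `h - 1`, or frontier nodes if `h =
0`; `live h` covers both cases. -/
theorem exists_mem_language {h : ℕ} :
    (∃ t : AlmostTree k (Fin s) h, (⟨h, t⟩ : FinAlmostTree k (Fin s)) ∈ X.language) ↔
      X.RootInto (X.live h) := by
  cases h with
  | zero =>
    constructor
    · rintro ⟨t, r, hr, hq, hl⟩
      cases t with
      | leaf a =>
        cases r with
        | node q rs =>
          refine ⟨_, hr, hq, fun i => ?_⟩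
          have := hl i
          dsimp only
          cases h : rs i with
          | leaf b =>
            rw [h] at this
            exact this
    · rintro ⟨⟨q, a, p⟩, ht, hq, hp⟩
      exact ⟨.leaf a, .node q fun i => .leaf (p i), ht, hq, hp⟩
  | succ h =>
    constructor
    · rintro ⟨t, r, hr, hq, hl⟩
      cases t with
      | node a ts =>
        cases r with
        | node q rs =>
          exact ⟨_, hr.1, hq, fun i => X.mem_live_succ.2 ⟨ts i, rs i, hr.2 i, rfl, hl i⟩⟩
    · rintro ⟨⟨q, a, p⟩, ht, hq, hp⟩
      choose ts rs h1 h2 h3 using fun i => X.mem_live_succ.1 (hp i)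
      refine ⟨.node a ts, .node q rs, ⟨?_, h1⟩, hq, h3⟩
      simp only [h2]
      exact ht

end AlmostTreeAutomaton

/-! ### Accepting lassos -/

/-- If `m` is at least the cardinality, two of the iterates up to that index coincide, and cutting
out the cycle between them gives a smaller exponent with the same value. -/
theorem exists_lt_card_iterate_eq {α : Type} [Fintype α] (f : α → α) (x : α) (m : ℕ) :
    ∃ m' < Fintype.card α, f^[m'] x = f^[m] x := by
  induction m using Nat.strong_induction_on with
  | _ m ih =>
    by_cases hm : m < Fintype.card α
    · exact ⟨m, hm, rfl⟩
    obtain ⟨i, j, hij, he⟩ := Fintype.exists_ne_map_eq_of_card_lt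
      (fun i : Fin (Fintype.card α + 1) => f^[i] x) (by simp)
    wlog hlt : i < j generalizing i j
    · exact this j i hij.symm he.symm (lt_of_le_of_ne (not_lt.1 hlt) hij.symm)
    have hj : (j : ℕ) ≤ m := by have := j.2; omega
    have hlt' : (i : ℕ) < j := hlt
    obtain ⟨m', hm', he'⟩ := ih (m - j + i) (by omega)
    refine ⟨m', hm', he'.trans ?_⟩
    have he : f^[i] x = f^[j] x := he
    rw [Function.iterate_add_apply, he, ← Function.iterate_add_apply, Nat.sub_add_cancel hj]

namespace TreeSeqAutomaton

variable {k s : ℕ} (A : TreeSeqAutomaton k s)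

/-- Some transition leads from `p` to `q` by reading a tree of height `h`. -/
def Edge (h : ℕ) (p q : Fin A.numStates) : Prop :=
  ∃ e ∈ A.trans, e.1 = p ∧ e.2.2 = q ∧ (A.letters e.2.1).RootInto ((A.letters e.2.1).live h)

/-- The run constrains the `i`-th tree only through membership in the language of one letter, so the
trees can be eliminated one by one, leaving a condition on live sets. -/
theorem language_inter_its_ne_empty : A.language ∩ ITS k (Fin s) ≠ ∅ ↔
    ∃ σ : ℕ → Fin A.numStates, σ 0 = A.start ∧ (∀ i, A.Edge i (σ i) (σ (i + 1))) ∧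
      ∃ q ∈ A.final, ∀ n, ∃ i, n ≤ i ∧ σ i = q := by
  rw [← Set.nonempty_iff_ne_empty]
  constructor
  · rintro ⟨g, ⟨σ, ⟨h0, hs⟩, hf⟩, hg⟩
    refine ⟨σ, h0, fun i => ?_, hf⟩
    obtain ⟨b, hb, hgi⟩ := hs i
    refine ⟨_, hb, rfl, rfl, AlmostTreeAutomaton.exists_mem_language _ |>.1 ?_⟩
    have hi : (g i).1 = i := hg i
    -- The height of `g i` equals `i` only propositionally, so the tree is generalized before
    -- substituting.
    generalize g i = t at hgi hi
    subst hi
    exact ⟨t.2, hgi⟩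
  · rintro ⟨σ, h0, hs, hf⟩
    have h1 : ∀ i, ∃ b, (σ i, b, σ (i + 1)) ∈ A.trans ∧ ∃ t : AlmostTree k (Fin s) i,
        (⟨i, t⟩ : FinAlmostTree k (Fin s)) ∈ (A.letters b).language := by
      intro i
      obtain ⟨⟨p, b, q⟩, he, hp, hq, hr⟩ := hs i
      dsimp only at hp hq
      subst hp hq
      exact ⟨b, he, (AlmostTreeAutomaton.exists_mem_language _).2 hr⟩
    choose b hb t ht using h1
    exact ⟨fun i => ⟨i, t i⟩, ⟨σ, ⟨h0, fun i => ⟨b i, hb i, ht i⟩⟩, hf⟩, fun i => rfl⟩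

/-- The states that can be reached from `S` by reading trees of height `x, …, x + d - 1`. -/
def reach (S : Set (Fin A.numStates)) (x : ℕ) : ℕ → Set (Fin A.numStates)
  | 0 => S
  | d + 1 => {q | ∃ p ∈ reach S x d, A.Edge (x + d) p q}

theorem exists_path {S : Set (Fin A.numStates)} {x d : ℕ} {q : Fin A.numStates}
    (h : q ∈ A.reach S x d) : ∃ τ : ℕ → Fin A.numStates, τ 0 ∈ S ∧ τ d = q ∧
      ∀ i < d, A.Edge (x + i) (τ i) (τ (i + 1)) := by
  induction d generalizing q with
  | zero => exact ⟨fun _ => q, h, rfl, by simp⟩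
  | succ d ih =>
    obtain ⟨p, hp, he⟩ := h
    obtain ⟨τ, h0, h1, h2⟩ := ih hp
    refine ⟨fun i => if i ≤ d then τ i else q, by simpa, by simp, fun i hi => ?_⟩
    rcases Nat.lt_succ_iff_lt_or_eq.1 hi with hi | rfl
    · simpa [hi.le, Nat.succ_le_of_lt hi] using h2 i hi
    · simpa [h1] using he

theorem mem_reach {σ : ℕ → Fin A.numStates} (hσ : ∀ i, A.Edge i (σ i) (σ (i + 1))) (x d : ℕ) :
    σ (x + d) ∈ A.reach {σ x} x d := by
  induction d with
  | zero => rfl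
  | succ d ih => exact ⟨_, ih, hσ (x + d)⟩

/-- An accepting lasso of size less than `C`. -/
def HasLassoLT (C : ℕ) : Prop :=
  ∃ q ∈ A.final, ∃ x < C, q ∈ A.reach {A.start} 0 x ∧ ∃ d < C, 0 < d ∧
    (∀ b, (A.letters b).live x = (A.letters b).live (x + d)) ∧ q ∈ A.reach {q} x d

/-- The sets of live states of all the letters, and a set of states. -/
abbrev Config : Type := (∀ b, Set (Fin (A.letters b).numStates)) × Set (Fin A.numStates)

/-- The next configuration. -/
def next (c : A.Config) : A.Config :=
  (fun b => (A.letters b).liveStep (c.1 b), {q | ∃ e ∈ A.trans, e.1 ∈ c.2 ∧ e.2.2 = q ∧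
    (A.letters e.2.1).RootInto (c.1 e.2.1)})

/-- The height enters an edge only through the live sets. Hence live sets and reachable states
evolve together under one time-independent map on a finite set, to which the pigeonhole principle
applies. -/
theorem iterate_next (S : Set (Fin A.numStates)) (x d : ℕ) :
    A.next^[d] (fun b => (A.letters b).live x, S) =
      (fun b => (A.letters b).live (x + d), A.reach S x d) := by
  induction d with
  | zero => rfl
  | succ d ih =>
    rw [Function.iterate_succ_apply', ih, next]
    refine Prod.ext (funext fun b => ?_) (Set.ext fun q => ?_)
    · exact (AlmostTreeAutomaton.live_succ _ _).symm
    · constructor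
      · rintro ⟨e, he, hp, hq, hr⟩
        exact ⟨_, hp, e, he, rfl, hq, hr⟩
      · rintro ⟨p, hp, e, he, rfl, hq, hr⟩
        exact ⟨e, he, hp, hq, hr⟩

/-- Among the infinitely many visits to `q`, two have the same vector of live sets. The stem up to
the first one and the loop between them are then shortened without changing the configurations at
their ends. -/
theorem hasLassoLT_of_run [Fintype A.Config] {C : ℕ} (hC : Fintype.card A.Config < C)
    {σ : ℕ → Fin A.numStates} (h0 : σ 0 = A.start) (hσ : ∀ i, A.Edge i (σ i) (σ (i + 1)))
    {q : Fin A.numStates} (hq : q ∈ A.final) (hinf : ∀ n, ∃ i, n ≤ i ∧ σ i = q) :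
    A.HasLassoLT C := by
  have hI : {i | σ i = q}.Infinite := Set.infinite_of_not_bddAbove fun ⟨n, hn⟩ => by
    obtain ⟨i, hi, he⟩ := hinf (n + 1)
    have : i ≤ n := hn he
    omega
  -- The empty second component is a dummy, so that finiteness of `A.Config` can be used for the
  -- live sets alone.
  obtain ⟨x, hx, y, hy, hxy, he⟩ := hI.exists_lt_map_eq_of_mapsTo
    (f := fun i => ((fun b => (A.letters b).live i, ∅) : A.Config)) (t := Set.univ)
    (fun _ _ => Set.mem_univ _) Set.finite_univ
  obtain ⟨d, rfl⟩ := Nat.exists_eq_add_of_lt hxy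
  have hx : σ x = q := hx
  have hy : σ (x + d + 1) = q := hy
  have hlive : (fun b => (A.letters b).live x) = fun b => (A.letters b).live (x + (d + 1)) :=
    (Prod.ext_iff.1 he).1
  have h1 := A.iterate_next {A.start} 0 x
  have h2 := A.iterate_next {q} x (d + 1)
  obtain ⟨x', hx', e1⟩ := exists_lt_card_iterate_eq A.next
    (fun b => (A.letters b).live 0, {A.start}) x
  -- The loop is shortened only after its first step, so its new length `d' + 1` is positive; it is
  -- at most the number of configurations, hence below `C`.
  obtain ⟨d', hd', e2⟩ := exists_lt_card_iterate_eq A.next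
    (A.next (fun b => (A.letters b).live x, {q})) d
  rw [← Function.iterate_succ_apply, ← Function.iterate_succ_apply] at e2
  rw [h1, A.iterate_next] at e1
  have e3 := congrArg Prod.fst e1
  have e4 := congrArg Prod.snd e1
  simp only [Nat.zero_add] at e3 e4
  rw [← e3, A.iterate_next, e3, h2, ← hlive, ← e3] at e2
  refine ⟨q, hq, x', hx'.trans hC, ?_, d' + 1, by omega, by omega, fun b => ?_, ?_⟩
  · rw [e4, ← h0, ← hx]
    simpa using A.mem_reach hσ 0 x
  · exact (congrFun (congrArg Prod.fst e2) b).symm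
  · rw [show A.reach {q} x' (d' + 1) = A.reach {q} x (d + 1) from congrArg Prod.snd e2]
    have := A.mem_reach hσ x (d + 1)
    rwa [hx, ← Nat.add_assoc, hy] at this

/-- Equality of the live sets at `x` and `x + d` propagates upwards, because each live set
determines the next. The edges after `x` thus have period `d`, and the loop may be repeated although
the trees keep growing. -/
theorem exists_run_of_hasLassoLT {C : ℕ} (h : A.HasLassoLT C) :
    ∃ σ : ℕ → Fin A.numStates, σ 0 = A.start ∧ (∀ i, A.Edge i (σ i) (σ (i + 1))) ∧
      ∃ q ∈ A.final, ∀ n, ∃ i, n ≤ i ∧ σ i = q := by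
  obtain ⟨q, hq, x, -, hx, d, -, hd, hlive, hr⟩ := h
  obtain ⟨τ, h0, h1, h2⟩ := A.exists_path hx
  obtain ⟨ρ, r0, r1, r2⟩ := A.exists_path hr
  have r0 : ρ 0 = q := r0
  have hper (b) : Function.Periodic (fun i => (A.letters b).live (x + i)) d := by
    suffices H : ∀ i, (A.letters b).live (x + (i + d)) = (A.letters b).live (x + i) from H
    intro i
    induction i with
    | zero => rw [Nat.zero_add, Nat.add_zero, ← hlive]
    | succ i ih =>
      rw [show x + (i + 1 + d) = x + (i + d) + 1 by ring, ← Nat.add_assoc x i 1,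
        AlmostTreeAutomaton.live_succ, AlmostTreeAutomaton.live_succ, ih]
  have hE (i p p') : A.Edge (x + i % d) p p' → A.Edge (x + i) p p' := by
    rintro ⟨e, he, hp, hp', hR⟩
    have : (A.letters e.2.1).live (x + i % d) = (A.letters e.2.1).live (x + i) :=
      (hper e.2.1).map_mod_nat i
    exact ⟨e, he, hp, hp', by rwa [this] at hR⟩
  refine ⟨fun i => if i < x then τ i else ρ ((i - x) % d), ?_, fun i => ?_, q, hq, fun n => ?_⟩
  · rcases Nat.eq_zero_or_pos x with rfl | hx0
    · simpa [r0, h1] using h0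
    · simpa [hx0] using h0
  · rcases lt_trichotomy (i + 1) x with hi | hi | hi
    · simpa [hi, (Nat.lt_succ_self i).trans hi] using h2 i ((Nat.lt_succ_self i).trans hi)
    · have := h2 i (by omega)
      rw [hi, h1] at this
      simpa [show i < x by omega, hi, r0] using this
    · obtain ⟨j, rfl⟩ := Nat.exists_eq_add_of_le (show x ≤ i by omega)
      simp only [show ¬ x + j < x by omega, show ¬ x + j + 1 < x by omega, if_false,
        show x + j - x = j by omega, show x + j + 1 - x = j + 1 by omega]
      have hj : j % d < d := Nat.mod_lt _ hd
      have := hE _ _ _ (r2 (j % d) hj)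
      rcases Nat.lt_or_ge (j % d + 1) d with hlt | hge
      · rwa [show (j + 1) % d = j % d + 1 by
          rw [← Nat.mod_add_mod, Nat.mod_eq_of_lt hlt]]
      · have e : j % d + 1 = d := by omega
        rw [e, r1, ← r0] at this
        rwa [show (j + 1) % d = 0 by rw [← Nat.mod_add_mod, e, Nat.mod_self]]
  · refine ⟨x + n * d, ?_, ?_⟩
    · have := Nat.le_mul_of_pos_right n hd
      omega
    · simp [r0]

theorem language_inter_its_ne_empty_iff [Fintype A.Config] {C : ℕ}
    (hC : Fintype.card A.Config < C) :
    A.language ∩ ITS k (Fin s) ≠ ∅ ↔ A.HasLassoLT C := by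
  rw [language_inter_its_ne_empty]
  constructor
  · rintro ⟨σ, h0, hσ, q, hq, hinf⟩
    exact A.hasLassoLT_of_run hC h0 hσ hq hinf
  · exact A.exists_run_of_hasLassoLT

end TreeSeqAutomaton

end TreeSeq

namespace TreeSeq

/-! ### The input numbers -/

/-- Digits come least significant first, so each is added with the current weight. The final weight
is left open because the separator resets it, and the power of two is known from `readState_pow`. -/
theorem foldl_encodePosNum (p : PosNum) (s : ReadState) : ∃ v e,
    ((Computability.encodePosNum p).map some).foldl readStep s =
      (s.1, s.2.1, s.2.2.1 + s.2.2.2.1 * (p : ℕ), v, e) := by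
  induction p generalizing s with
  | one => exact ⟨2 * s.2.2.2.1, 2 * s.2.2.2.2, by
      simp [Computability.encodePosNum, readStep]⟩
  | bit0 p ih =>
    obtain ⟨v, e, h⟩ := ih (readStep s (some false))
    refine ⟨v, e, ?_⟩
    rw [Computability.encodePosNum, List.map_cons, List.foldl_cons, h]
    simp only [readStep, PosNum.cast_bit0, Prod.mk.injEq, and_true, true_and]
    ring
  | bit1 p ih =>
    obtain ⟨v, e, h⟩ := ih (readStep s (some true))
    refine ⟨v, e, ?_⟩
    rw [Computability.encodePosNum, List.map_cons, List.foldl_cons, h]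
    simp only [readStep, PosNum.cast_bit1, Prod.mk.injEq, and_true, true_and]
    ring

theorem foldl_encodeNat (n : ℕ) (s : ReadState) : ∃ v e,
    ((Computability.encodeNat n).map some).foldl readStep s =
      (s.1, s.2.1, s.2.2.1 + s.2.2.2.1 * n, v, e) := by
  have h := Num.to_of_nat n
  rw [Computability.encodeNat]
  cases hn : (n : Num) with
  | zero =>
    rw [hn] at h
    exact ⟨s.2.2.2.1, s.2.2.2.2, by simp [← h, Computability.encodeNum]⟩
  | pos p =>
    rw [hn, Num.cast_pos] at h
    rw [← h]
    exact foldl_encodePosNum p s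

theorem foldl_encodeNats (l : List ℕ) (s : ReadState) (h1 : s.2.2.1 = 0) (h2 : s.2.2.2.1 = 1) :
    ((encodeNats l).foldl readStep s).1 = l.foldl (fun L n => Nat.pair n L) s.1 ∧
      ((encodeNats l).foldl readStep s).2.1 = s.2.1 + l.length := by
  induction l generalizing s with
  | nil => simp [encodeNats]
  | cons n l ih =>
    obtain ⟨v, e, h⟩ := foldl_encodeNat n s
    have e1 : (encodeNats (n :: l)).foldl readStep s = (encodeNats l).foldl readStep
        (readStep (s.1, s.2.1, s.2.2.1 + s.2.2.2.1 * n, v, e) none) := by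
      rw [← h]
      simp [encodeNats]
    rw [e1]
    obtain ⟨h3, h4⟩ := ih (readStep (s.1, s.2.1, s.2.2.1 + s.2.2.2.1 * n, v, e) none) rfl rfl
    refine ⟨by rw [h3]; simp [readStep, h1, h2], ?_⟩
    rw [h4, List.length_cons]
    simp only [readStep]
    omega

/-- The empty list has code `0`, which unpairs to two zeros; so positions past the end yield the
default value. -/
theorem nthCode_listCode (l : List ℕ) (j : ℕ) : nthCode (listCode l) j = l.getD j 0 := by
  have h : (Nat.rec (listCode l) (fun _ r => r.unpair.2) j : ℕ) = listCode (l.drop j) := by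
    induction j with
    | zero => rfl
    | succ j ih =>
      simp only [ih]
      rw [← List.tail_drop]
      cases l.drop j <;> simp [listCode]
  have h' : l.getD j 0 = (l.drop j).headD 0 := by simp [List.head?_drop]
  rw [nthCode, h, h']
  cases l.drop j <;> simp [listCode]

theorem tok_dataOf (l : List ℕ) (j : ℕ) :
    tok (dataOf (encodeNats l)) j = l.reverse.getD (l.length - 1 - j) 0 := by
  obtain ⟨h1, h2⟩ := foldl_encodeNats l (0, 0, 0, 1, 1) rfl rfl
  rw [tok, ← nthCode_listCode, listCode, List.foldr_reverse, dataOf]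
  simp only [readState, h1, h2, Nat.zero_add]

theorem tok_dataOf_of_lt {l : List ℕ} {j : ℕ} (hj : j < l.length) :
    tok (dataOf (encodeNats l)) j = l[j] := by
  rw [tok_dataOf, List.getD_eq_getElem _ _ (by rw [List.length_reverse]; omega),
    List.getElem_reverse]
  congr 1
  omega

theorem lt_two_pow_length_encodePosNum (p : PosNum) :
    (p : ℕ) < 2 ^ (Computability.encodePosNum p).length := by
  induction p with
  | one => simp [Computability.encodePosNum]
  | bit0 p ih =>
    rw [Computability.encodePosNum, List.length_cons, PosNum.cast_bit0, pow_succ]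
    omega
  | bit1 p ih =>
    rw [Computability.encodePosNum, List.length_cons, PosNum.cast_bit1, pow_succ]
    omega

theorem lt_two_pow_length_encodeNat (n : ℕ) : n < 2 ^ (Computability.encodeNat n).length := by
  have h := Num.to_of_nat n
  rw [Computability.encodeNat]
  cases hn : (n : Num) with
  | zero =>
    rw [hn] at h
    rw [← h]
    simp
  | pos p =>
    rw [hn, Num.cast_pos] at h
    rw [← h]
    exact lt_two_pow_length_encodePosNum p

theorem lt_two_pow_of_mem {l : List ℕ} {n : ℕ} (h : n ∈ l) : n < 2 ^ (encodeNats l).length := by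
  refine (lt_two_pow_length_encodeNat n).trans_le (Nat.pow_le_pow_right (by omega) ?_)
  induction l with
  | nil => simp at h
  | cons m l ih =>
    rw [encodeNats, List.flatMap_cons, List.length_append, ← encodeNats]
    rcases List.mem_cons.1 h with rfl | h
    · simp
      omega
    · have := ih h
      omega

theorem dataOf_fst (w : List (Option Bool)) :
    (dataOf w).1 = 2 ^ (2 ^ w.length * 2 ^ w.length) := by
  rw [dataOf, readState_pow]

/-! ### Parsing -/

/-- The input numbers from position `o` on are those of the list `m`. -/
def At (c : Data) (o : ℕ) (m : List ℕ) : Prop := ∀ i v, m[i]? = some v → tok c (o + i) = v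

section Parse

variable {c : Data} {o : ℕ}

theorem At.append {m m' : List ℕ} (h : At c o (m ++ m')) : At c o m ∧ At c (o + m.length) m' := by
  refine ⟨fun i v hi => h i v ?_, fun i v hi => ?_⟩
  · rw [List.getElem?_append_left (List.getElem?_eq_some_iff.1 hi).1, hi]
  · rw [Nat.add_assoc]
    refine h _ v ?_
    rw [List.getElem?_append_right (by omega), Nat.add_sub_cancel_left, hi]

theorem At.cons {n : ℕ} {m : List ℕ} (h : At c o (n :: m)) : tok c o = n ∧ At c (o + 1) m :=
  ⟨h 0 n rfl, (At.append (m := [n]) h).2⟩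

theorem At.flatMap {α : Type} {f : α → List ℕ} {n : ℕ} (hf : ∀ a, (f a).length = n) {l : List α}
    (h : At c o (l.flatMap f)) {i : ℕ} {a : α} (hi : l[i]? = some a) :
    At c (o + i * n) (f a) := by
  induction l generalizing o i with
  | nil => simp at hi
  | cons b l ih =>
    rw [List.flatMap_cons] at h
    obtain ⟨h1, h2⟩ := h.append
    cases i with
    | zero =>
      obtain rfl : b = a := by simpa using hi
      simpa using h1
    | succ i =>
      have := ih h2 (by simpa using hi)
      rwa [hf, Nat.add_assoc, show n + i * n = (i + 1) * n by ring] at this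

theorem length_flatMap_const {α : Type} {f : α → List ℕ} {n : ℕ} (hf : ∀ a, (f a).length = n)
    (l : List α) : (l.flatMap f).length = l.length * n := by
  induction l with
  | nil => simp
  | cons a l ih => rw [List.flatMap_cons, List.length_append, hf, ih, List.length_cons]; ring

theorem exists_lt_length_iff {α : Type} {l : List α} {n : ℕ} (hn : n = l.length) {P : ℕ → Prop}
    {Q : α → Prop} (h : ∀ i a, l[i]? = some a → (P i ↔ Q a)) :
    (∃ i < n, P i) ↔ ∃ a ∈ l, Q a := by
  subst hn
  constructor
  · rintro ⟨i, hi, hP⟩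
    exact ⟨l[i], List.getElem_mem hi, (h i _ (List.getElem?_eq_getElem hi)).1 hP⟩
  · rintro ⟨a, ha, hQ⟩
    obtain ⟨i, hi⟩ := List.mem_iff_getElem?.1 ha
    exact ⟨i, (List.getElem?_eq_some_iff.1 hi).1, (h i a hi).2 hQ⟩

theorem At.codeTrans {n s m : ℕ} {t : Fin n × Fin s × (Fin m → Fin n)}
    (h : At c o (codeTrans t)) : tok c o = t.1 ∧ ∀ i : Fin m, tok c (o + (2 + i)) = t.2.2 i := by
  obtain ⟨h1, h2⟩ := h.cons
  refine ⟨h1, fun i => ?_⟩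
  have := h2.cons.2 i (t.2.2 i) (by simp)
  rwa [show o + 1 + 1 + (i : ℕ) = o + (2 + i) by ring] at this

theorem length_codeTrans {n s m : ℕ} (t : Fin n × Fin s × (Fin m → Fin n)) :
    (codeTrans t).length = m + 2 := by
  simp [TreeSeq.codeTrans]

/-- The number `S` represents the set `A`. -/
def Codes {n : ℕ} (S : ℕ) (A : Set (Fin n)) : Prop :=
  ∀ q, S.testBit q = true ↔ ∃ h : q < n, ⟨q, h⟩ ∈ A

theorem Codes.mem {n S : ℕ} {A : Set (Fin n)} (h : Codes S A) (q : Fin n) :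
    S.testBit q = true ↔ q ∈ A :=
  (h q).trans ⟨fun ⟨_, hq⟩ => hq, fun hq => ⟨q.2, hq⟩⟩

/-- `Codes` also forces the bits at positions `n` and above to vanish, so the number is unique and
equality of sets can be tested on numbers. -/
theorem Codes.eq_iff {n S S' : ℕ} {A A' : Set (Fin n)} (h : Codes S A) (h' : Codes S' A') :
    S = S' ↔ A = A' := by
  constructor
  · rintro rfl
    ext q
    rw [← h.mem, h'.mem]
  · rintro rfl
    refine Nat.eq_of_testBit_eq fun q => ?_
    rw [Bool.eq_iff_iff, h q, h' q]

/-- The code of `A` is below `2 ^ n ≤ B`, so the search meets a solution. It tests only bits below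
`B`, but its result is at most `B`, so all higher bits are zero anyway. -/
theorem codes_bitset {n B : ℕ} (hB : 2 ^ n ≤ B) {P : ℕ → Prop} {A : Set (Fin n)}
    (h : ∀ q, P q ↔ ∃ h : q < n, ⟨q, h⟩ ∈ A) : Codes (bitset B P) A := by
  classical
  have hbits (q : ℕ) : (Nat.ofBits fun i : Fin n => decide (i ∈ A)).testBit q = true ↔ P q := by
    rw [h]
    by_cases hq : q < n
    · rw [Nat.testBit_ofBits_lt _ _ hq]
      simp [hq]
    · rw [Nat.testBit_ofBits_ge _ _ (not_lt.1 hq)]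
      simp [hq]
  have hspec := search_spec (n := B) (P := fun S => ∀ q < B, S.testBit q = true ↔ P q)
    ⟨_, (Nat.ofBits_lt_two_pow _).trans_le hB, fun q _ => hbits q⟩
  intro q
  rw [← h]
  by_cases hq : q < B
  · exact hspec q hq
  · have h1 : bitset B P ≤ B := search_le _ _
    have h2 : bitset B P < 2 ^ q := (h1.trans (not_lt.1 hq)).trans_lt Nat.lt_two_pow_self
    rw [Nat.testBit_lt_two_pow h2, h]
    refine ⟨by simp, fun ⟨hqn, _⟩ => ?_⟩
    have := (Nat.lt_two_pow_self (n := n)).trans_le hB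
    omega

theorem codes_bitset_eq {n B : ℕ} (hB : 2 ^ n ≤ B) (q : Fin n) :
    Codes (bitset B fun p => p = q) ({q} : Set (Fin n)) :=
  codes_bitset hB fun _ => ⟨fun h => ⟨h ▸ q.2, Fin.ext h⟩, fun ⟨_, h⟩ => congrArg Fin.val h⟩

/-! ### Correctness of the procedure on encoded automata -/

variable {k s : ℕ} {X : AlmostTreeAutomaton k s}

theorem AlmostTreeAutomaton.parse (hc : arity c = k) (hk : 2 ≤ k) (h : At c o X.code) :
    tok c o = X.numStates ∧ tok c (o + 1) = X.start ∧
    numRoot c o = X.rootTrans.length ∧ (∀ i t, X.rootTrans[i]? = some t →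
      At c (o + 3 + i * (k + 1)) (codeTrans t)) ∧
    numTrans c o = X.trans.length ∧ (∀ i t, X.trans[i]? = some t →
      At c (posTrans c o + 1 + i * (k + 2)) (codeTrans t)) ∧
    numFinal c o = X.final.length ∧ (∀ i (q : Fin X.numStates), X.final[i]? = some q →
      tok c (posFinal c o + 1 + i) = q) ∧ posNext c o = o + X.code.length := by
  -- Here `k - 1 + 2 = k + 1`, as `k` is positive and the subtraction does not truncate.
  have l1 (t : Fin X.numStates × Fin s × (Fin (k - 1) → Fin X.numStates)) :
      (codeTrans t).length = k + 1 := by rw [length_codeTrans]; omega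
  have l2 (t : Fin X.numStates × Fin s × (Fin k → Fin X.numStates)) :
      (codeTrans t).length = k + 2 := length_codeTrans t
  have l3 (q : Fin X.numStates) : [q.1].length = 1 := rfl
  simp only [AlmostTreeAutomaton.code, List.cons_append, List.nil_append] at h
  obtain ⟨h1, h⟩ := h.cons
  obtain ⟨h2, h⟩ := h.cons
  obtain ⟨h3, h⟩ := h.append
  obtain ⟨h4, h5⟩ := h.append
  have e1 : (codeList codeTrans X.rootTrans).length = 1 + X.rootTrans.length * (k + 1) := by
    rw [codeList, List.length_cons, length_flatMap_const l1, Nat.add_comm]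
  have e2 : (codeList codeTrans X.trans).length = 1 + X.trans.length * (k + 2) := by
    rw [codeList, List.length_cons, length_flatMap_const l2, Nat.add_comm]
  have e3 : (codeList (fun q : Fin X.numStates => [q.1]) X.final).length =
      1 + X.final.length := by
    rw [codeList, List.length_cons, length_flatMap_const l3, Nat.add_comm, Nat.mul_one]
  obtain ⟨h6, h7⟩ := h3.cons
  have r1 : numRoot c o = X.rootTrans.length := h6
  have p1 : posTrans c o = o + 1 + 1 + (codeList codeTrans X.rootTrans).length := by
    rw [posTrans, r1, hc, e1]
    ring
  rw [← p1] at h4 h5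
  obtain ⟨h8, h9⟩ := h4.cons
  have r2 : numTrans c o = X.trans.length := h8
  have p2 : posFinal c o = posTrans c o + (codeList codeTrans X.trans).length := by
    rw [posFinal, r2, hc, e2]
    ring
  rw [← p2] at h5
  obtain ⟨h10, h11⟩ := h5.cons
  have r3 : numFinal c o = X.final.length := h10
  refine ⟨h1, h2, r1, fun i t hi => h7.flatMap l1 hi, r2, fun i t hi => h9.flatMap l2 hi, r3,
    fun i q hi => ?_, ?_⟩
  · have := (h11.flatMap l3 hi).cons.1
    rwa [Nat.mul_one] at this
  · rw [posNext, r3, p2, p1, AlmostTreeAutomaton.code]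
    simp only [List.length_append, List.length_cons, List.length_nil, e1, e2, e3]
    ring

theorem codes_liveSet (hc : arity c = k) (hk : 2 ≤ k) (h : At c o X.code)
    (hB : 2 ^ X.numStates ≤ c.1) (d : ℕ) : Codes (liveSet c o d) (X.live d) := by
  obtain ⟨-, -, -, -, n2, t2, n3, t3, -⟩ := X.parse hc hk h
  induction d with
  | zero =>
    refine codes_bitset hB fun q => (exists_lt_length_iff n3 (Q := fun p => p.1 = q)
      fun i p hi => by rw [t3 i p hi]).trans ⟨?_, ?_⟩
    · rintro ⟨p, hp, rfl⟩
      exact ⟨p.2, hp⟩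
    · rintro ⟨hq, hp⟩
      exact ⟨_, hp, rfl⟩
  | succ d ih =>
    rw [X.live_succ]
    change Codes (bitset c.1 fun q => ∃ i < numTrans c o,
      tok c (posTrans c o + 1 + i * (arity c + 2)) = q ∧ ∀ j < arity c, (liveSet c o d).testBit
        (tok c (posTrans c o + 1 + i * (arity c + 2) + (2 + j))) = true) _
    refine codes_bitset hB fun q => (exists_lt_length_iff n2
      (Q := fun t => t.1.1 = q ∧ ∀ i, t.2.2 i ∈ X.live d) fun i t hi => ?_).trans ⟨?_, ?_⟩
    · obtain ⟨h1, h2⟩ := (t2 i t hi).codeTrans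
      rw [hc, h1]
      refine and_congr_right fun _ => ⟨fun hj i => ?_, fun hj i hi => ?_⟩
      · rw [← ih.mem, ← h2]
        exact hj i i.2
      · have := h2 ⟨i, hi⟩
        dsimp only at this
        rw [this]
        exact (ih.mem _).2 (hj ⟨i, hi⟩)
    · rintro ⟨t, ht, rfl, hs⟩
      exact ⟨t.1.2, t, ht, rfl, hs⟩
    · rintro ⟨hq, t, ht, he, hs⟩
      exact ⟨t, ht, congrArg Fin.val he, hs⟩

theorem accepts_iff (hc : arity c = k) (hk : 2 ≤ k) (h : At c o X.code)
    (hB : 2 ^ X.numStates ≤ c.1) (d : ℕ) : Accepts c o d ↔ X.RootInto (X.live d) := by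
  obtain ⟨-, hs, n1, t1, -⟩ := X.parse hc hk h
  have ih := codes_liveSet hc hk h hB d
  refine exists_lt_length_iff n1 fun i t hi => ?_
  obtain ⟨h1, h2⟩ := (t1 i t hi).codeTrans
  rw [hc, h1, hs, Fin.ext_iff]
  refine and_congr_right fun _ => ⟨fun hj i => ?_, fun hj i hi => ?_⟩
  · rw [← ih.mem, ← h2]
    exact hj i i.2
  · have := h2 ⟨i, hi⟩
    dsimp only at this
    rw [this]
    exact (ih.mem _).2 (hj ⟨i, hi⟩)

end Parse

/-- Five numbers come before the first letter: arity, alphabet size, number of states, initial state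
and number of letters. Codes of letters vary in length, so each position is found by parsing the
preceding code. -/
theorem posLetter_parse {c : Data} {k s M : ℕ} (hc : arity c = k) (hk : 2 ≤ k)
    {Y : Fin M → AlmostTreeAutomaton k s} {r : List ℕ}
    (h : At c 5 ((List.ofFn Y).flatMap AlmostTreeAutomaton.code ++ r)) (b : ℕ) (hb : b ≤ M) :
    At c (posLetter c b) (((List.ofFn Y).drop b).flatMap AlmostTreeAutomaton.code ++ r) := by
  induction b with
  | zero => exact h
  | succ b ih =>
    have hlt : b < (List.ofFn Y).length := by rw [List.length_ofFn]; omega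
    have := ih (by omega)
    rw [List.drop_eq_getElem_cons hlt, List.flatMap_cons, List.append_assoc] at this
    obtain ⟨h1, h2⟩ := this.append
    rwa [← (AlmostTreeAutomaton.parse hc hk h1).2.2.2.2.2.2.2.2] at h2

theorem hasLasso_iff {c : Data} {k s : ℕ} (hk : 2 ≤ k) (A : TreeSeqAutomaton k s)
    (h : At c 0 ([k, s] ++ A.code)) (hB : 2 ^ A.numStates ≤ c.1)
    (hBl : ∀ b, 2 ^ (A.letters b).numStates ≤ c.1) : HasLasso c ↔ A.HasLassoLT c.1 := by
  simp only [TreeSeqAutomaton.code, codeList.eq_def AlmostTreeAutomaton.code, List.cons_append,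
    List.nil_append] at h
  obtain ⟨hc, h⟩ := h.cons
  obtain ⟨-, h⟩ := h.cons
  obtain ⟨-, h⟩ := h.cons
  obtain ⟨hstart, h⟩ := h.cons
  obtain ⟨hM, h⟩ := h.cons
  rw [List.length_ofFn] at hM
  have hM : numLetter c = A.numLetters := hM
  have hst : tok c 3 = A.start := hstart
  have hp := posLetter_parse hc hk h
  have hlet (b : Fin A.numLetters) : At c (posLetter c b) (A.letters b).code := by
    have h1 := hp b b.2.le
    rw [List.drop_eq_getElem_cons (by simp), List.flatMap_cons, List.append_assoc] at h1
    have h2 := h1.append.1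
    rwa [List.getElem_ofFn] at h2
  have hrest := hp A.numLetters le_rfl
  rw [List.drop_eq_nil_of_le (by simp), List.flatMap_nil, List.nil_append,
    ← show posEdge c = posLetter c A.numLetters by rw [posEdge, hM]] at hrest
  obtain ⟨h1, h2⟩ := hrest.append
  have l1 (t : Fin A.numStates × Fin A.numLetters × Fin A.numStates) :
    [t.1.1, t.2.1.1, t.2.2.1].length = 3 := rfl
  obtain ⟨h3, h4⟩ := h1.cons
  have hE : numEdge c = A.trans.length := h3
  rw [codeList, List.length_cons, length_flatMap_const l1,
    show posEdge c + (A.trans.length * 3 + 1) = posAcc c by rw [posAcc, hE]; ring] at h2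
  obtain ⟨hF, h5⟩ := h2.cons
  have hedge {i : ℕ} {t} (hi : A.trans[i]? = some t) :
      tok c (posEdge c + 1 + i * 3) = t.1 ∧ tok c (posEdge c + 1 + i * 3 + 1) = t.2.1 ∧
        tok c (posEdge c + 1 + i * 3 + 2) = t.2.2 := by
    have := h4.flatMap l1 hi
    exact ⟨this 0 _ rfl, this 1 _ rfl, this 2 _ rfl⟩
  have hacc {i : ℕ} {q} (hi : A.final[i]? = some q) : tok c (posAcc c + 1 + i) = q := by
    have := (h5.flatMap (fun q : Fin A.numStates => show [q.1].length = 1 from rfl) hi).cons.1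
    rwa [Nat.mul_one] at this
  have hlive (b : Fin A.numLetters) (x : ℕ) := codes_liveSet hc hk (hlet b) (hBl b) x
  have hreach {S : ℕ} {S' : Set (Fin A.numStates)} (hS : Codes S S') (x d : ℕ) :
      Codes (reachSet c S x d) (A.reach S' x d) := by
    induction d with
    | zero => exact hS
    | succ d ih =>
      refine codes_bitset hB fun q => (exists_lt_length_iff hE (Q := fun e => e.2.2.1 = q ∧
        e.1 ∈ A.reach S' x d ∧ (A.letters e.2.1).RootInto ((A.letters e.2.1).live (x + d)))
        fun i e hi => ?_).trans ⟨?_, ?_⟩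
      · obtain ⟨e1, e2, e3⟩ := hedge hi
        rw [e1, e2, e3]
        refine and_congr_right fun _ => and_congr (ih.mem _) ?_
        exact accepts_iff hc hk (hlet _) (hBl _) _
      · rintro ⟨e, he, rfl, hp, hR⟩
        exact ⟨e.2.2.2, e.1, hp, e, he, rfl, rfl, hR⟩
      · rintro ⟨hq, p, hp, e, he, rfl, hq', hR⟩
        exact ⟨e, he, congrArg Fin.val hq', hp, hR⟩
  have hS := codes_bitset_eq hB
  have hper (x d : ℕ) : (∀ b < numLetter c, liveSet c (posLetter c b) x =
      liveSet c (posLetter c b) (x + d)) ↔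
      ∀ b, (A.letters b).live x = (A.letters b).live (x + d) := by
    rw [hM]
    exact ⟨fun H b => ((hlive b _).eq_iff (hlive b _)).1 (H b b.2),
      fun H b hb => ((hlive ⟨b, hb⟩ _).eq_iff (hlive ⟨b, hb⟩ _)).2 (H ⟨b, hb⟩)⟩
  have key (q : Fin A.numStates) : (∃ x < c.1, (reachSet c (bitset c.1 fun p => p = tok c 3) 0
      x).testBit q = true ∧ ∃ d < c.1, 0 < d ∧ (∀ b < numLetter c, liveSet c (posLetter c b) x =
          liveSet c (posLetter c b) (x + d)) ∧
        (reachSet c (bitset c.1 fun p => p = q) x d).testBit q = true) ↔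
      ∃ x < c.1, q ∈ A.reach {A.start} 0 x ∧ ∃ d < c.1, 0 < d ∧
        (∀ b, (A.letters b).live x = (A.letters b).live (x + d)) ∧ q ∈ A.reach {q} x d := by
    simp only [hst, hper, (hreach (hS _) _ _).mem]
  constructor
  · rintro ⟨q, -, hq, hr⟩
    obtain ⟨p, hp, rfl⟩ := (exists_lt_length_iff hF (Q := fun p => p.1 = q)
      fun i p hi => by rw [hacc hi]).1 hq
    exact ⟨p, hp, (key p).1 hr⟩
  · rintro ⟨q, hq, hr⟩
    exact ⟨q, (q.2.trans Nat.lt_two_pow_self).trans_le hB, (exists_lt_length_iff hF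
      (Q := fun p => p.1 = q.1) fun i p hi => by rw [hacc hi]).2 ⟨q, hq, rfl⟩, (key q).2 hr⟩

/-- Every input number is below `E`, so `2 ^ E` would suffice as a bound for the bitsets. The square
in `2 ^ (E * E)` is needed for the configurations, which have a set of states for each of up to `E -
1` letters. -/
theorem Instance.hasLasso_iff (I : Instance) :
    I.aut.language ∩ ITS I.k (Fin I.s) ≠ ∅ ↔ HasLasso (dataOf I.encode) := by
  set l := [I.k, I.s] ++ I.aut.code with hl
  set E := 2 ^ (encodeNats l).length with hE
  have hdata : (dataOf (encodeNats l)).1 = 2 ^ (E * E) := dataOf_fst _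
  have hat : At (dataOf (encodeNats l)) 0 l := fun i v hi => by
    obtain ⟨h, rfl⟩ := List.getElem?_eq_some_iff.1 hi
    rw [Nat.zero_add, tok_dataOf_of_lt h]
  have hmem {n : ℕ} (h : n ∈ I.aut.code) : n < E := lt_two_pow_of_mem (by simp [hl, h])
  have hN : I.aut.numStates < E := hmem (by simp [TreeSeqAutomaton.code])
  have hM : I.aut.numLetters < E := hmem (by simp [TreeSeqAutomaton.code, codeList])
  have hNb (b) : (I.aut.letters b).numStates < E := hmem (by
    simp only [TreeSeqAutomaton.code, codeList, List.mem_append, List.mem_cons, List.mem_flatMap]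
    exact .inr (.inl (.inr ⟨_, (List.mem_ofFn' _ _).2 ⟨b, rfl⟩, by
      simp [AlmostTreeAutomaton.code]⟩)))
  have hEE : E ≤ E * E := Nat.le_mul_self E
  have hpow {n : ℕ} (h : n < E) : 2 ^ n ≤ (dataOf (encodeNats l)).1 := by
    rw [hdata]
    exact Nat.pow_le_pow_right (by omega) (h.le.trans hEE)
  rw [TreeSeqAutomaton.language_inter_its_ne_empty_iff (C := (dataOf (encodeNats l)).1)]
  · exact (TreeSeq.hasLasso_iff I.two_le I.aut hat (hpow hN) fun b => hpow (hNb b)).symm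
  · rw [Fintype.card_prod, Fintype.card_pi, hdata]
    simp only [Fintype.card_set, Fintype.card_fin]
    rw [Finset.prod_pow_eq_pow_sum, ← pow_add]
    refine Nat.pow_lt_pow_right (by omega) ?_
    have h1 : ∑ b, (I.aut.letters b).numStates ≤ I.aut.numLetters * (E - 1) := by
      have := Finset.sum_le_card_nsmul Finset.univ (fun b => (I.aut.letters b).numStates) (E - 1)
        fun b _ => by have := hNb b; omega
      simpa using this
    have h2 : I.aut.numLetters * (E - 1) ≤ (E - 1) * (E - 1) := Nat.mul_le_mul_right _ (by omega)
    obtain ⟨e, he⟩ : ∃ e, E = e + 1 := ⟨E - 1, by omega⟩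
    rw [he, Nat.add_sub_cancel] at h1 h2
    -- With `e = E - 1`, the exponents add up to at most `e * e + e`, which is less than `(e + 1) *
    -- (e + 1)`.
    rw [he, show (e + 1) * (e + 1) = e * e + 2 * e + 1 by ring]
    omega

end TreeSeq

theorem mainTheorem8 :
    TreeSeq.InTwoExpTime TreeSeq.Instance.encode
      (fun I => I.aut.language ∩ TreeSeq.ITS I.k (Fin I.s) ≠ ∅) :=
  TreeSeq.inTwoExpTime_of_hasLasso TreeSeq.Instance.hasLasso_iff
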